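/- \textbf{Definitions.} A \emph{metrized graph} $\Gamma$ is a compact connected metric space in which every point $p$ has a neighbourhood isometric, with $p$ corresponding to the centre, to a star-shaped set with $n_p\ge 1$ arms of some length $r_p>0$, endowed with its path metric; $n_p$ is the \emph{valence} of $p$, and the $n_p$ arms are the \emph{directions} $\vec v\in\mathrm{Vec}(p)$. A \emph{vertex set} of $\Gamma$ is a finite non-empty set $V\subset\Gamma$ which contains all points of valence $\neq 2$, such that the closure of every connected component of $\Gamma\setminus V$ is isometric to a line segment $[0,L]$ with $L>0$ (these closures are the \emph{segments} of $\Gamma$ with respect to $V$; $L_e$ is the length of the segment $e$), and such that two different segments are disjoint or meet in exactly one point, which is an endpoint of both. Let $S(\Gamma)$ be the set of continuous $f:\Gamma\to\mathbb R$ which have a derivative $D_{\vec v}f(p)$ at every point $p$ in every direction $\vec v$ and for which there is a vertex set such that $f$ is twice continuously differentiable with bounded second derivative (with respect to arc length) on the interior of each of its segments. For $f\in S(\Gamma)$ the \emph{Laplacian} is the signed measure \[ \Delta f=-f''(x)\,dx-\sum_{p\in\Gamma}\Big(\sum_{\vec v\in \mathrm{Vec}(p)}D_{\vec v}f(p)\Big)\delta_p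 , \] where $dx$ is arc length (Lebesgue measure) on $\Gamma$. A function $f\in S(\Gamma)$ is \emph{piecewise affine} if moreover the vertex set can be chosen so that $f$ is affine in arc length on each segment. For $y,z\in\Gamma$ let $x\mapsto j_z(x,y)$ be the unique piecewise affine function with $\Delta_x j_z(x,y)=\delta_y(x)-\delta_z(x)$ and $j_z(z,y)=0$; the \emph{effective resistance} is $r(x,y)=j_y(x,x)$. The \emph{canonical measure} of $\Gamma$ is \[ \mu_{\rm can}=\tfrac12\,\Delta_x r(x,y)+\delta_y(x),\qquad y\in\Gamma \text{ arbitrary}. \] \textbf{Theorem.} Let $\Gamma$ be a metrized graph and let $V$ be a vertex set of $\Gamma$. Then the set of segments of $\Gamma$ with respect to $V$ is finite, and for every $y\in\Gamma$ the function $x\mapsto r(x,y)$ belongs to $S(\Gamma)$ and \[ \tfrac12\,\Delta_x r(x,y)+\delta_y(x)=\sum_{p\in V}\Big(1-\tfrac12 n_p\Big)\delta_p+\sum_{\text{segments } e}\frac{1}{R_e+L_e}\,dx|_e . \] In particular the left side, $\mu_{\rm can}$, does not depend on $y$. Here, for a segment $e$, $\Gamma_e$ denotes the complement in $\Gamma$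 of the interior of $e$ (that is, of $e$ without its endpoints), and $R_e$ is the effective resistance between the endpoints of $e$ computed on the metrized graph $\Gamma_e$ if $\Gamma_e$ is connected, and $R_e=\infty$ (so that $\frac1{R_e+L_e}=0$) if $\Gamma_e$ is not connected. -/

import Mathlib

open Set Filter Topology MeasureTheory

noncomputable section

namespace MetrizedGraph

section Structure

variable {Γ : Type*} [MetricSpace Γ]

/-- The `n` maps `φ k : [0, r) → Γ` are the arms of an isometry from the star-shaped set of
valence `n ≥ 1` and radius `r`, endowed with its path metric, onto a neighbourhood of `p`, which
sends the centre of the star to `p`. Two points of the star at distances `a`, `b` from its centre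
have path distance `|a - b|` if they lie on the same arm, and `a + b` otherwise. -/
structure IsStarChart (p : Γ) (n : ℕ) (r : ℝ) (φ : Fin n → ℝ → Γ) : Prop where
  one_le : 1 ≤ n
  r_pos : 0 < r
  center : ∀ k, φ k 0 = p
  dist_same : ∀ k, ∀ a ∈ Ico 0 r, ∀ b ∈ Ico 0 r, dist (φ k a) (φ k b) = |a - b|
  dist_ne : ∀ k l, k ≠ l → ∀ a ∈ Ico 0 r, ∀ b ∈ Ico 0 r, dist (φ k a) (φ l b) = a + b
  nhds : (⋃ k, φ k '' Ico 0 r) ∈ 𝓝 p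

variable (Γ) in
/-- A metrized graph: a compact connected metric space in which every point has a neighbourhood
isometric to a star-shaped set of valence at least one. -/
structure IsMetrizedGraph : Prop where
  compact : CompactSpace Γ
  connected : ConnectedSpace Γ
  star : ∀ p : Γ, ∃ (n : ℕ) (r : ℝ) (φ : Fin n → ℝ → Γ), IsStarChart p n r φ

open Classical in
/-- The valence of `p`, together with the arms of a star-shaped neighbourhood of `p`. The valence,
and the germs at `0` of the arms up to their order, do not depend on the star that is chosen. -/
def starAt (p : Γ) : Σ n : ℕ, Fin n → ℝ → Γ :=
  if h : ∃ c : (Σ n : ℕ, Fin n → ℝ → Γ), ∃ r, IsStarChart p c.1 r c.2 then h.choose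
  else ⟨0, fun k => k.elim0⟩

/-- The valence `n_p`. -/
def valence (p : Γ) : ℕ := (starAt p).1

/-- The directions at `p` are indexed by `Fin (valence p)`; `arm p k ε` is the point
of `Γ` at distance `ε` from `p` in the `k`-th direction, for small `ε ≥ 0`. -/
def arm (p : Γ) (k : Fin (valence p)) : ℝ → Γ := (starAt p).2 k

theorem exists_isStarChart_arm (hΓ : IsMetrizedGraph Γ) (p : Γ) :
    ∃ r, IsStarChart p (valence p) r (arm p) := by
  obtain ⟨n, r, φ, h⟩ := hΓ.star p
  have h' : ∃ c : (Σ n : ℕ, Fin n → ℝ → Γ), ∃ r, IsStarChart p c.1 r c.2 := ⟨⟨n, φ⟩, r, h⟩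
  have key : ∃ r, IsStarChart p (starAt p).1 r (starAt p).2 := by
    rw [starAt, dif_pos h']
    exact h'.choose_spec
  exact key

/-- `s` restricted to `[0, L]` is an isometry onto `e`, where `L > 0`. -/
structure IsParam (e : Set Γ) (L : ℝ) (s : ℝ → Γ) : Prop where
  pos : 0 < L
  dist_eq : ∀ a ∈ Icc 0 L, ∀ b ∈ Icc 0 L, dist (s a) (s b) = |a - b|
  image_eq : s '' Icc 0 L = e

/-- `p` is one of the two ends of the line segment `e` (reversing a parametrization
exchanges the ends). -/
def IsEndpoint (e : Set Γ) (p : Γ) : Prop := ∃ L s, IsParam e L s ∧ s 0 = p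

/-- The segments cut out by `V`: the closures of the connected components of `Γ ∖ V`. -/
def segments (V : Set Γ) : Set (Set Γ) :=
  {e | ∃ x ∈ Vᶜ, e = closure (connectedComponentIn Vᶜ x)}

/-- Vertex sets of a metrized graph. -/
structure IsVertexSet (V : Set Γ) : Prop where
  finite : V.Finite
  nonempty : V.Nonempty
  valence_ne_two : ∀ p, valence p ≠ 2 → p ∈ V
  segment : ∀ e ∈ segments V, ∃ L s, IsParam e L s
  inter : ∀ e ∈ segments V, ∀ e' ∈ segments V, e ≠ e' →
    e ∩ e' = ∅ ∨ ∃ p, e ∩ e' = {p} ∧ IsEndpoint e p ∧ IsEndpoint e' p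

/-- The derivative of `f` at `p` in the `k`-th direction. -/
def dirDeriv (f : Γ → ℝ) (p : Γ) (k : Fin (valence p)) : ℝ :=
  derivWithin (fun t => f (arm p k t)) (Ici 0) 0

/-- `σ_p(f)`, the sum of the directional derivatives of `f` at `p`. -/
def slopeSum (f : Γ → ℝ) (p : Γ) : ℝ := ∑ k, dirDeriv f p k

/-- `s` is an isometry from an open interval around `0` onto a neighbourhood of `x`,
with `s 0 = x`. -/
def IsLocalParam (x : Γ) (s : ℝ → Γ) : Prop :=
  s 0 = x ∧ ∃ ε > 0, (∀ a ∈ Ioo (-ε) ε, ∀ b ∈ Ioo (-ε) ε, dist (s a) (s b) = |a - b|) ∧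
    s '' Ioo (-ε) ε ∈ 𝓝 x

open Classical in
/-- The second derivative `f''(x)` with respect to arc length (both orientations give the same
value); it is given the value `0` at the finitely many points of valence other than two. -/
def secondDeriv (f : Γ → ℝ) (x : Γ) : ℝ :=
  if h : ∃ s, IsLocalParam x s then iteratedDeriv 2 (fun t => f (h.choose t)) 0 else 0

/-- `f` is continuous, has all directional derivatives, and is twice continuously differentiable
with bounded second derivative on the interior of each segment cut out by `V`. -/
structure IsSmoothWrt (V : Set Γ) (f : Γ → ℝ) : Prop where
  continuous : Continuous f
  dirDeriv : ∀ p k, DifferentiableWithinAt ℝ (fun t => f (arm p k t)) (Ici 0) 0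
  contDiff : ∀ e ∈ segments V, ∀ L s, IsParam e L s →
    ContDiffOn ℝ 2 (fun t => f (s t)) (Ioo 0 L)
  bounded : ∀ e ∈ segments V, ∀ L s, IsParam e L s →
    ∃ C, ∀ t ∈ Ioo 0 L, |iteratedDeriv 2 (fun u => f (s u)) t| ≤ C

/-- The class `S(Γ)` of piecewise smooth functions. -/
def IsPiecewiseSmooth (f : Γ → ℝ) : Prop := ∃ V, IsVertexSet V ∧ IsSmoothWrt V f

/-- The class `A(Γ)` of piecewise affine functions. -/
def IsPiecewiseAffine (f : Γ → ℝ) : Prop :=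
  ∃ V, IsVertexSet V ∧ IsSmoothWrt V f ∧
    ∀ e ∈ segments V, ∀ L s, IsParam e L s → ∃ A B : ℝ, ∀ t ∈ Icc 0 L, f (s t) = A * t + B

end Structure

section Laplacian

variable {Γ : Type*} [MetricSpace Γ] [MeasurableSpace Γ] [BorelSpace Γ]

variable (Γ) in
/-- Lebesgue measure `dx` on `Γ`, i.e. arc length: the one-dimensional Hausdorff measure. -/
def arcLength : Measure Γ := Measure.hausdorffMeasure 1

/-- The unit point mass at `p`, as a signed measure. -/
def pointMass (p : Γ) : SignedMeasure Γ := (Measure.dirac p).toSignedMeasure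

/-- The signed measure `dx|_e`. -/
def arcLengthOn (e : Set Γ) : SignedMeasure Γ :=
  (arcLength Γ).withDensityᵥ (e.indicator (fun _ => (1 : ℝ)))

/-- The Laplacian `Δf = -f''(x) dx - ∑_p σ_p(f) δ_p` of a function `f ∈ S(Γ)`. -/
def laplacian (f : Γ → ℝ) : SignedMeasure Γ :=
  -(arcLength Γ).withDensityᵥ (secondDeriv f) - ∑ᶠ p, slopeSum f p • pointMass p

/-- `j` is the piecewise affine function with `Δj = δ_y - δ_z` and `j(z) = 0`. -/
structure IsPotential (z y : Γ) (j : Γ → ℝ) : Prop where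
  affine : IsPiecewiseAffine j
  laplacian_eq : laplacian j = pointMass y - pointMass z
  grounded : j z = 0

open Classical in
/-- The function `x ↦ j_z(x, y)`; on a metrized graph `IsPotential z y` determines it uniquely. -/
def jFun (z y : Γ) : Γ → ℝ :=
  if h : ∃ j, IsPotential z y j then h.choose else 0

/-- The effective resistance `r(x, y) = j_y(x, x)`. -/
def effResistance (x y : Γ) : ℝ := jFun y x x

/-- `½ Δ_x r(x, y) + δ_y`. -/
def canonicalMeasure (y : Γ) : SignedMeasure Γ :=
  (1 / 2 : ℝ) • laplacian (fun x => effResistance x y) + pointMass y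

open Classical in
/-- The effective resistance between `y` and `z` computed on the subspace `A` of `Γ`, which is to
contain both. -/
def effResistanceOn (A : Set Γ) (y z : Γ) : ℝ :=
  if h : y ∈ A ∧ z ∈ A then effResistance (⟨y, h.1⟩ : A) (⟨z, h.2⟩ : A) else 0

open Classical in
/-- `R_e` for a segment `e` parametrized by `s : [0, L] → e`: the effective resistance between the
endpoints of `e` on the complement `Γ_e` of the interior of `e` if `Γ_e` is connected, and `∞`
otherwise. -/
def deletedResistance (L : ℝ) (s : ℝ → Γ) : EReal :=
  if IsConnected (s '' Ioo 0 L)ᶜ then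
    ((effResistanceOn (s '' Ioo 0 L)ᶜ (s 0) (s L) : ℝ) : EReal)
  else ⊤

end Laplacian

end MetrizedGraph

end

open MetrizedGraph

/-!
A vertex set `W` turns `Γ` into a finite simple weighted graph: the arms at a vertex `p` correspond
to the segments ending at `p` (`exists_arm_equiv_neighbours`), so that for a function `f` which is
affine on the segments the sum of the slopes at `p` is `∑_q (f q - f p) / L_{pq}` over the
neighbours `q` of `p`. Hence Green's identity `∑ g Δf = ∑ f Δg` holds on `W` (`green`). At a point
where a locally affine function is maximal all slopes are nonpositive, so the set where a harmonic
function is maximal is open and closed, and by connectedness such a function is constant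
(`IsLocallyAffine.eq_of_slopeSum_eq_zero`). This gives uniqueness of potentials and, as an injective
endomorphism of a finite-dimensional space is surjective, their existence
(`exists_isQuadratic_slopeSum`); Green's identity gives the symmetry `j_y(x, z) = j_y(z, x)`.

Let `y ∈ W`, let `s` run through a segment from `a` to `b` of length `L`, and put
`G u v = j_y(u, v)`. Adjoining `s t` to `W` (`IsVertexSet.insert`) and solving the equation for the
slopes of `j_y(·, s t)` at `s t`, one finds that `r(s t, y)` is a quadratic polynomial in `t` with
leading coefficient `ρ / L² - 1 / L` and linear coefficient `2 (G a b - G a a) / L + 1`, where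
`ρ = r(a, b)` (`effResistance_apply`). So the density of the canonical measure on the segment is
`1 / L - ρ / L²`. The slopes of `r(·, y)` at a vertex `p` add up to twice the slopes of `j_y(·, p)`
at `p` plus the valence of `p`, that is to `2 (δ_y(p) - 1) + n_p`, which gives the masses
`1 - n_p / 2` (`canonicalMeasure_eq`). Neither expression involves `y`.

It remains to see that `1 / L - ρ / L² = 1 / (R + L)`, i.e. that a segment `e` and its complement
`Γ_e` are connected in parallel. If `Γ_e` is connected, it is a metrized graph with vertex set `W`,
and the potential on `Γ_e` between the ends of `e`, extended affinely over `e`, is `1 + R / L` times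
the potential on `Γ`, whence `R = (1 + R / L) ρ` (`effResistanceOn_eq_mul`). If `Γ_e` is not
connected, the function with values `L` and `0` on its two parts, affine on `e`, is the potential on
`Γ`, whence `ρ = L` (`effResistance_of_not_isConnected`).
-/

noncomputable section

namespace MetrizedGraph

/-! ### Parametrized line segments -/

/-- An isometry from a set of reals containing `0` into `ℝ` is a translation or a reflection. -/
theorem isometry_real_eq {I : Set ℝ} (h0 : (0 : ℝ) ∈ I) {ψ : ℝ → ℝ}
    (h : ∀ a ∈ I, ∀ b ∈ I, |ψ a - ψ b| = |a - b|) :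
    (∀ a ∈ I, ψ a = ψ 0 + a) ∨ (∀ a ∈ I, ψ a = ψ 0 - a) := by
  have key : ∀ a ∈ I, ψ a = ψ 0 + a ∨ ψ a = ψ 0 - a := by
    intro a ha
    have := h a ha 0 h0
    rw [sub_zero] at this
    rcases abs_eq_abs.1 this with h | h
    · left; linarith
    · right; linarith
  by_contra! hc
  obtain ⟨⟨a, ha, hna⟩, ⟨b, hb, hnb⟩⟩ := hc
  have ha' := (key a ha).resolve_left hna
  have hb' := (key b hb).resolve_right hnb
  have := h a ha b hb
  rw [ha', hb'] at this
  rcases abs_eq_abs.1 this with h | h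
  · apply hna; rw [ha']; linarith
  · apply hnb; rw [hb']; linarith

section Param

variable {Γ : Type*} [MetricSpace Γ] {e : Set Γ} {L : ℝ} {s : ℝ → Γ}

namespace IsParam

theorem zero_mem (h : IsParam e L s) : (0 : ℝ) ∈ Icc 0 L := ⟨le_rfl, h.pos.le⟩

theorem length_mem (h : IsParam e L s) : L ∈ Icc 0 L := ⟨h.pos.le, le_rfl⟩

theorem apply_mem (h : IsParam e L s) {t : ℝ} (ht : t ∈ Icc 0 L) : s t ∈ e :=
  h.image_eq ▸ mem_image_of_mem _ ht

theorem dist_left (h : IsParam e L s) {t : ℝ} (ht : t ∈ Icc 0 L) : dist (s t) (s 0) = t := by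
  rw [h.dist_eq t ht 0 h.zero_mem, sub_zero, abs_of_nonneg ht.1]

theorem dist_ends (h : IsParam e L s) : dist (s 0) (s L) = L := by
  rw [dist_comm, h.dist_left h.length_mem]

theorem injOn (h : IsParam e L s) : InjOn s (Icc 0 L) := by
  intro a ha b hb hab
  rw [← h.dist_left ha, ← h.dist_left hb, hab]

theorem ends_ne (h : IsParam e L s) : s 0 ≠ s L := fun H =>
  h.pos.ne (h.injOn h.zero_mem h.length_mem H)

theorem dist_mem (h : IsParam e L s) {x : Γ} (hx : x ∈ e) : dist x (s 0) ∈ Icc 0 L := by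
  obtain ⟨t, ht, rfl⟩ := h.image_eq ▸ hx
  rwa [h.dist_left ht]

theorem apply_dist (h : IsParam e L s) {x : Γ} (hx : x ∈ e) : s (dist x (s 0)) = x := by
  obtain ⟨t, ht, rfl⟩ := h.image_eq ▸ hx
  rw [h.dist_left ht]

theorem reverse (h : IsParam e L s) : IsParam e L (fun t => s (L - t)) where
  pos := h.pos
  dist_eq a ha b hb := by
    rw [h.dist_eq _ ⟨by linarith [ha.2], by linarith [ha.1]⟩ _
      ⟨by linarith [hb.2], by linarith [hb.1]⟩, abs_sub_comm a b]
    congr 1; ring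
  image_eq := by
    rw [← h.image_eq]
    ext x
    constructor
    · rintro ⟨t, ht, rfl⟩
      exact ⟨L - t, ⟨by linarith [ht.2], by linarith [ht.1]⟩, rfl⟩
    · rintro ⟨t, ht, rfl⟩
      exact ⟨L - t, ⟨by linarith [ht.2], by linarith [ht.1]⟩, by simp⟩

theorem subinterval (h : IsParam e L s) {t : ℝ} (ht : t ∈ Ioc 0 L) :
    IsParam (s '' Icc 0 t) t s where
  pos := ht.1
  dist_eq a ha b hb := h.dist_eq a ⟨ha.1, ha.2.trans ht.2⟩ b ⟨hb.1, hb.2.trans ht.2⟩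
  image_eq := rfl

theorem continuousOn (h : IsParam e L s) : ContinuousOn s (Icc 0 L) := by
  have : LipschitzOnWith 1 s (Icc 0 L) := by
    refine LipschitzOnWith.of_dist_le_mul fun a ha b hb => ?_
    rw [h.dist_eq a ha b hb, NNReal.coe_one, one_mul, Real.dist_eq]
  exact this.continuousOn

theorem isCompact (h : IsParam e L s) : IsCompact e := by
  rw [← h.image_eq]; exact isCompact_Icc.image_of_continuousOn h.continuousOn

theorem isClosed (h : IsParam e L s) : IsClosed e := h.isCompact.isClosed

/-- A map into a segment which is isometric on a set `I ∋ 0` is a translation or a reflection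
in the coordinate of the segment. -/
theorem eq_translate (h : IsParam e L s) {I : Set ℝ} (h0 : (0 : ℝ) ∈ I) {φ : ℝ → Γ}
    (hφ : ∀ a ∈ I, ∀ b ∈ I, dist (φ a) (φ b) = |a - b|) (hmem : ∀ a ∈ I, φ a ∈ e) :
    ∃ t₀ ∈ Icc 0 L,
      (∀ a ∈ I, t₀ + a ∈ Icc 0 L ∧ φ a = s (t₀ + a)) ∨
      (∀ a ∈ I, t₀ - a ∈ Icc 0 L ∧ φ a = s (t₀ - a)) := by
  have hiso : ∀ a ∈ I, ∀ b ∈ I, |dist (φ a) (s 0) - dist (φ b) (s 0)| = |a - b| := by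
    intro a ha b hb
    rw [← hφ a ha b hb, ← h.dist_eq _ (h.dist_mem (hmem a ha)) _ (h.dist_mem (hmem b hb)),
      h.apply_dist (hmem a ha), h.apply_dist (hmem b hb)]
  refine ⟨dist (φ 0) (s 0), h.dist_mem (hmem 0 h0), ?_⟩
  rcases isometry_real_eq (ψ := fun a => dist (φ a) (s 0)) h0 hiso with H | H
  · left
    intro a ha
    have h1 := h.dist_mem (hmem a ha)
    have h2 := h.apply_dist (hmem a ha)
    rw [H a ha] at h1 h2
    exact ⟨h1, h2.symm⟩
  · right
    intro a ha
    have h1 := h.dist_mem (hmem a ha)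
    have h2 := h.apply_dist (hmem a ha)
    rw [H a ha] at h1 h2
    exact ⟨h1, h2.symm⟩

theorem length_le {L' : ℝ} {s' : ℝ → Γ} (h : IsParam e L s) (h' : IsParam e L' s') : L' ≤ L := by
  have h1 := h.dist_eq _ (h.dist_mem (h'.apply_mem h'.zero_mem)) _
    (h.dist_mem (h'.apply_mem h'.length_mem))
  rw [h.apply_dist (h'.apply_mem h'.zero_mem), h.apply_dist (h'.apply_mem h'.length_mem),
    h'.dist_ends] at h1
  have h2 := h.dist_mem (h'.apply_mem h'.zero_mem)
  have h3 := h.dist_mem (h'.apply_mem h'.length_mem)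
  rw [h1, abs_le]
  constructor <;> linarith [h2.1, h2.2, h3.1, h3.2]

theorem length_unique {L' : ℝ} {s' : ℝ → Γ} (h : IsParam e L s) (h' : IsParam e L' s') :
    L' = L := le_antisymm (h.length_le h') (h'.length_le h)

/-- Up to reversal, a segment has only one parametrization. -/
theorem eq_or_reverse {L' : ℝ} {s' : ℝ → Γ} (h : IsParam e L s) (h' : IsParam e L' s') :
    L' = L ∧ ((∀ t ∈ Icc 0 L, s' t = s t) ∨ (∀ t ∈ Icc 0 L, s' t = s (L - t))) := by
  obtain rfl := h.length_unique h'
  refine ⟨rfl, ?_⟩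
  obtain ⟨t₀, ht₀, H | H⟩ := h.eq_translate h'.zero_mem h'.dist_eq (fun a ha => h'.apply_mem ha)
  · have h0 : t₀ = 0 := by linarith [(H L' h'.length_mem).1.2, ht₀.1]
    left; intro t ht; rw [(H t ht).2, h0, zero_add]
  · have h0 : t₀ = L' := by linarith [(H L' h'.length_mem).1.1, ht₀.2]
    right; intro t ht; rw [(H t ht).2, h0]

theorem isEndpoint_iff (h : IsParam e L s) {p : Γ} : IsEndpoint e p ↔ p = s 0 ∨ p = s L := by
  constructor
  · rintro ⟨L', s', h', rfl⟩
    rcases (h.eq_or_reverse h').2 with H | H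
    · left; exact H 0 h.zero_mem
    · right; simpa using H 0 h.zero_mem
  · rintro (rfl | rfl)
    · exact ⟨L, s, h, rfl⟩
    · exact ⟨L, _, h.reverse, by simp⟩

/-- The open segment is what is left of the segment when its ends are removed. -/
theorem image_Ioo (h : IsParam e L s) : s '' Ioo 0 L = e \ {s 0, s L} := by
  ext x
  constructor
  · rintro ⟨t, ht, rfl⟩
    have ht' := Ioo_subset_Icc_self ht
    refine ⟨h.apply_mem ht', ?_⟩
    rintro (H | H)
    · exact ht.1.ne' (h.injOn ht' h.zero_mem H)
    · exact ht.2.ne (h.injOn ht' h.length_mem H)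
  · rintro ⟨hx, hne⟩
    obtain ⟨t, ht, rfl⟩ := h.image_eq ▸ hx
    refine ⟨t, ⟨ht.1.lt_of_ne ?_, ht.2.lt_of_ne ?_⟩, rfl⟩
    · rintro rfl; exact hne (Or.inl rfl)
    · rintro rfl; exact hne (Or.inr rfl)

end IsParam

end Param

/-! ### Star-shaped neighbourhoods -/

section Star

variable {Γ : Type*} [MetricSpace Γ] {p : Γ} {n : ℕ} {r : ℝ} {φ : Fin n → ℝ → Γ}

namespace IsStarChart

theorem dist_center (h : IsStarChart p n r φ) (k : Fin n) {a : ℝ} (ha : a ∈ Ico 0 r) :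
    dist (φ k a) p = a := by
  rw [← h.center k, h.dist_same k a ha 0 ⟨le_rfl, h.r_pos⟩, sub_zero, abs_of_nonneg ha.1]

theorem mono (h : IsStarChart p n r φ) {r' : ℝ} (h0 : 0 < r') (hr : r' ≤ r) :
    IsStarChart p n r' φ where
  one_le := h.one_le
  r_pos := h0
  center := h.center
  dist_same k a ha b hb := h.dist_same k a ⟨ha.1, ha.2.trans_le hr⟩ b ⟨hb.1, hb.2.trans_le hr⟩
  dist_ne k l hkl a ha b hb :=
    h.dist_ne k l hkl a ⟨ha.1, ha.2.trans_le hr⟩ b ⟨hb.1, hb.2.trans_le hr⟩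
  nhds := by
    filter_upwards [h.nhds, Metric.ball_mem_nhds p h0] with x hx hxp
    obtain ⟨k, a, ha, rfl⟩ := mem_iUnion.1 hx
    rw [Metric.mem_ball, h.dist_center k ha] at hxp
    exact mem_iUnion.2 ⟨k, a, ⟨ha.1, hxp⟩, rfl⟩

theorem continuousOn (h : IsStarChart p n r φ) (k : Fin n) : ContinuousOn (φ k) (Ico 0 r) := by
  have : LipschitzOnWith 1 (φ k) (Ico 0 r) := by
    refine LipschitzOnWith.of_dist_le_mul fun a ha b hb => ?_
    rw [h.dist_same k a ha b hb, NNReal.coe_one, one_mul, Real.dist_eq]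
  exact this.continuousOn

theorem isPreconnected (h : IsStarChart p n r φ) : IsPreconnected (⋃ k, φ k '' Ico 0 r) := by
  refine isPreconnected_iUnion ⟨p, mem_iInter.2 fun k => ⟨0, ⟨le_rfl, h.r_pos⟩, h.center k⟩⟩
    fun k => isPreconnected_Ico.image _ (h.continuousOn k)

theorem exists_mono (h : IsStarChart p n r φ) {U : Set Γ} (hU : U ∈ 𝓝 p) :
    ∃ ε > 0, ε ≤ r ∧ IsStarChart p n ε φ ∧ ∀ k, ∀ t ∈ Ico 0 ε, φ k t ∈ U := by
  obtain ⟨ε, hε, hb⟩ := Metric.mem_nhds_iff.1 hU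
  refine ⟨min ε r, lt_min hε h.r_pos, min_le_right _ _,
    h.mono (lt_min hε h.r_pos) (min_le_right _ _), fun k t ht => hb ?_⟩
  rw [Metric.mem_ball, h.dist_center k ⟨ht.1, ht.2.trans_le (min_le_right _ _)⟩]
  exact ht.2.trans_le (min_le_left _ _)

/-- The points of a star at a small distance from its centre are as many as its arms. -/
theorem exists_ncard_sphere (h : IsStarChart p n r φ) :
    ∃ ε > 0, ∀ t ∈ Ioo 0 ε, (Metric.sphere p t).ncard = n := by
  obtain ⟨ε, hε, hb⟩ := Metric.mem_nhds_iff.1 h.nhds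
  refine ⟨min ε r, lt_min hε h.r_pos, fun t ht => ?_⟩
  have htr : t ∈ Ico 0 r := ⟨ht.1.le, ht.2.trans_le (min_le_right _ _)⟩
  have himg : Metric.sphere p t = range (fun k => φ k t) := by
    ext x
    constructor
    · intro hx
      have hx' : x ∈ Metric.ball p ε := by
        rw [Metric.mem_ball, Metric.mem_sphere.1 hx]; exact ht.2.trans_le (min_le_left _ _)
      obtain ⟨k, a, ha, rfl⟩ := mem_iUnion.1 (hb hx')
      rw [Metric.mem_sphere, h.dist_center k ha] at hx
      exact ⟨k, by rw [hx]⟩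
    · rintro ⟨k, rfl⟩
      exact h.dist_center k htr
  have hinj : Function.Injective (fun k => φ k t) := by
    intro k l hkl
    by_contra hne
    have := h.dist_ne k l hne t htr t htr
    simp only at hkl
    rw [hkl, dist_self] at this
    linarith [ht.1]
  rw [himg, ← image_univ, ncard_image_of_injective _ hinj, ncard_univ, Nat.card_fin]

end IsStarChart

theorem locallyConnectedSpace (hΓ : IsMetrizedGraph Γ) : LocallyConnectedSpace Γ := by
  rw [locallyConnectedSpace_iff_connected_subsets]
  intro p U hU
  obtain ⟨n, r, φ, h⟩ := hΓ.star p
  obtain ⟨ε, -, -, h', hmem⟩ := h.exists_mono hU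
  refine ⟨_, h'.nhds, h'.isPreconnected, ?_⟩
  intro x hx
  obtain ⟨k, a, ha, rfl⟩ := mem_iUnion.1 hx
  exact hmem k a ha

/-- The valence can be read off from small spheres, hence does not depend on the chart. -/
theorem exists_ncard_sphere_eq_valence (hΓ : IsMetrizedGraph Γ) (p : Γ) :
    ∃ ε > 0, ∀ t ∈ Ioo 0 ε, (Metric.sphere p t).ncard = valence p := by
  obtain ⟨r, h⟩ := exists_isStarChart_arm hΓ p
  exact h.exists_ncard_sphere

end Star

/-! ### The segments cut out by a vertex set -/

section Segments

variable {Γ : Type*} [MetricSpace Γ] {W : Set Γ} {e e' : Set Γ} {L L' : ℝ} {s s' : ℝ → Γ}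

/-- A connected open set disjoint from `W` whose boundary lies in `W` is a component of `Wᶜ`. -/
theorem connectedComponentIn_compl_eq {C : Set Γ} (hC : IsOpen C) (hpre : IsPreconnected C)
    (hCW : C ⊆ Wᶜ) (hbd : closure C ⊆ C ∪ W) {x : Γ} (hx : x ∈ C) :
    connectedComponentIn Wᶜ x = C := by
  refine Subset.antisymm ?_ (hpre.subset_connectedComponentIn hx hCW)
  have hK := isPreconnected_connectedComponentIn (x := x) (F := Wᶜ)
  by_contra hnot
  obtain ⟨z, hz, hzC⟩ := not_subset.1 hnot
  have hzW : z ∈ Wᶜ := connectedComponentIn_subset _ _ hz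
  have hxK : x ∈ connectedComponentIn Wᶜ x := mem_connectedComponentIn (hCW hx)
  obtain ⟨w, hw, hwC, hwD⟩ := hK C (closure C)ᶜ hC isClosed_closure.isOpen_compl
    (fun u hu => by
      by_cases huC : u ∈ C
      · exact Or.inl huC
      · refine Or.inr fun hcl => ?_
        exact (hbd hcl).elim huC (connectedComponentIn_subset _ _ hu)) ⟨x, hxK, hx⟩
    ⟨z, hz, fun hcl => (hbd hcl).elim hzC hzW⟩
  exact hwD (subset_closure hwC)

theorem IsVertexSet.exists_params (hW : IsVertexSet W) :
    ∃ (L : Set Γ → ℝ) (s : Set Γ → ℝ → Γ), ∀ e ∈ segments W, IsParam e (L e) (s e) := by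
  have h : ∀ e, ∃ L s, e ∈ segments W → IsParam e L s := by
    intro e
    by_cases he : e ∈ segments W
    · obtain ⟨L, s, hs⟩ := hW.segment e he
      exact ⟨L, s, fun _ => hs⟩
    · exact ⟨0, fun _ => hW.nonempty.some, fun h => absurd h he⟩
  choose L s hs using h
  exact ⟨L, s, hs⟩

theorem isOpen_component (hΓ : IsMetrizedGraph Γ) (hW : IsVertexSet W) (x : Γ) :
    IsOpen (connectedComponentIn Wᶜ x) := by
  have := locallyConnectedSpace hΓ
  exact hW.finite.isClosed.isOpen_compl.connectedComponentIn

theorem closure_component_subset (hΓ : IsMetrizedGraph Γ) (hW : IsVertexSet W) (x : Γ) :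
    closure (connectedComponentIn Wᶜ x) ⊆ connectedComponentIn Wᶜ x ∪ W := by
  intro z hz
  by_cases hzW : z ∈ W
  · exact Or.inr hzW
  left
  have hzz : z ∈ connectedComponentIn Wᶜ z := mem_connectedComponentIn hzW
  obtain ⟨w, hw, hw'⟩ := mem_closure_iff.1 hz _ (isOpen_component hΓ hW z) hzz
  rw [connectedComponentIn_eq hw', ← connectedComponentIn_eq hw]
  exact hzz

/-- A point with a neighbourhood inside a segment of which it is an end has valence one. -/
theorem valence_ne_two_of_segment_nhds (hΓ : IsMetrizedGraph Γ) (hp : IsParam e L s)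
    {U : Set Γ} (hU : U ∈ 𝓝 (s 0)) (hUe : U ⊆ e) : valence (s 0) ≠ 2 := by
  intro h2
  obtain ⟨r, h⟩ := exists_isStarChart_arm hΓ (s 0)
  obtain ⟨ε, hε, -, h', hmem⟩ := h.exists_mono hU
  have ht : ε / 2 ∈ Ico 0 ε := ⟨by linarith, by linarith⟩
  have key : ∀ k, arm (s 0) k (ε / 2) = s (ε / 2) := by
    intro k
    have := hp.apply_dist (hUe (hmem k _ ht))
    rw [h'.dist_center k ht] at this
    exact this.symm
  have hlt0 : 0 < valence (s 0) := by omega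
  have hlt1 : 1 < valence (s 0) := by omega
  have := h'.dist_ne ⟨0, hlt0⟩ ⟨1, hlt1⟩ (by simp) _ ht _ ht
  rw [key, key, dist_self] at this
  linarith

/-- The component of `Wᶜ` whose closure is the segment `e` is the open segment. -/
theorem component_eq_image_Ioo (hΓ : IsMetrizedGraph Γ) (hW : IsVertexSet W) {x : Γ}
    (hp : IsParam (closure (connectedComponentIn Wᶜ x)) L s) :
    connectedComponentIn Wᶜ x = s '' Ioo 0 L ∧ s 0 ∈ W ∧ s L ∈ W := by
  set C := connectedComponentIn Wᶜ x with hC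
  have hopen : IsOpen C := isOpen_component hΓ hW x
  have hCW : C ⊆ Wᶜ := connectedComponentIn_subset _ _
  -- an end of the segment that lay in `C` would have valence one
  have hnot : ∀ σ : ℝ → Γ, IsParam (closure C) L σ → σ 0 ∉ C := by
    intro σ hσ hmem
    have := valence_ne_two_of_segment_nhds hΓ hσ (hopen.mem_nhds hmem) subset_closure
    exact hCW hmem (hW.valence_ne_two _ this)
  have h0 := hnot s hp
  have hL : s L ∉ C := by simpa using hnot _ hp.reverse
  refine ⟨?_, ?_, ?_⟩
  · apply Subset.antisymm
    · rw [hp.image_Ioo]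
      intro z hz
      refine ⟨subset_closure hz, ?_⟩
      rintro (rfl | rfl)
      · exact h0 hz
      · exact hL hz
    · rintro _ ⟨t, ht, rfl⟩
      -- the distance from `s 0` takes on `C` values below and above `t`
      have hpre : IsPreconnected ((fun z => dist z (s 0)) '' C) :=
        isPreconnected_connectedComponentIn.image _
          (continuous_id.dist continuous_const).continuousOn
      obtain ⟨u, hu, hut⟩ := Metric.mem_closure_iff.1 (hp.apply_mem hp.zero_mem) t ht.1
      obtain ⟨v, hv, hvt⟩ := Metric.mem_closure_iff.1 (hp.apply_mem hp.length_mem) (L - t)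
        (by linarith [ht.2])
      have hvt' : t ≤ dist v (s 0) := by
        have := dist_triangle (s 0) v (s L)
        rw [hp.dist_ends, dist_comm (s 0), dist_comm v (s L)] at this
        linarith
      have hmem : t ∈ (fun z => dist z (s 0)) '' C := by
        refine hpre.ordConnected.out ⟨u, hu, rfl⟩ ⟨v, hv, rfl⟩ ⟨?_, hvt'⟩
        rw [dist_comm] at hut; exact hut.le
      obtain ⟨c, hc, hct⟩ := hmem
      have := hp.apply_dist (subset_closure hc)
      simp only at hct
      rw [hct] at this
      rwa [this]
  · exact (closure_component_subset hΓ hW x (hp.apply_mem hp.zero_mem)).resolve_left h0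
  · exact (closure_component_subset hΓ hW x (hp.apply_mem hp.length_mem)).resolve_left hL

theorem ends_mem (hΓ : IsMetrizedGraph Γ) (hW : IsVertexSet W) (he : e ∈ segments W)
    (hp : IsParam e L s) : s 0 ∈ W ∧ s L ∈ W := by
  obtain ⟨x, -, rfl⟩ := he
  exact (component_eq_image_Ioo hΓ hW hp).2

theorem isOpen_image_Ioo (hΓ : IsMetrizedGraph Γ) (hW : IsVertexSet W) (he : e ∈ segments W)
    (hp : IsParam e L s) : IsOpen (s '' Ioo 0 L) := by
  obtain ⟨x, -, rfl⟩ := he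
  rw [← (component_eq_image_Ioo hΓ hW hp).1]
  exact isOpen_component hΓ hW x

theorem image_Ioo_subset_compl (hΓ : IsMetrizedGraph Γ) (hW : IsVertexSet W)
    (he : e ∈ segments W) (hp : IsParam e L s) : s '' Ioo 0 L ⊆ Wᶜ := by
  obtain ⟨x, -, rfl⟩ := he
  rw [← (component_eq_image_Ioo hΓ hW hp).1]
  exact connectedComponentIn_subset _ _

theorem apply_notMem (hΓ : IsMetrizedGraph Γ) (hW : IsVertexSet W)
    (he : e ∈ segments W) (hp : IsParam e L s) {t : ℝ} (ht : t ∈ Ioo 0 L) : s t ∉ W :=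
  image_Ioo_subset_compl hΓ hW he hp (mem_image_of_mem _ ht)

theorem mem_image_Ioo_of_notMem (hΓ : IsMetrizedGraph Γ) (hW : IsVertexSet W)
    (he : e ∈ segments W) (hp : IsParam e L s) {x : Γ} (hx : x ∈ e) (hxW : x ∉ W) :
    x ∈ s '' Ioo 0 L := by
  obtain ⟨h0, h1⟩ := ends_mem hΓ hW he hp
  rw [hp.image_Ioo]
  refine ⟨hx, ?_⟩
  rintro (rfl | rfl)
  · exact hxW h0
  · exact hxW h1

/-- The segment through a point outside the vertex set. -/
theorem eq_closure_of_mem (hΓ : IsMetrizedGraph Γ) (hW : IsVertexSet W) (he : e ∈ segments W)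
    {x : Γ} (hx : x ∈ e) (hxW : x ∉ W) : e = closure (connectedComponentIn Wᶜ x) := by
  obtain ⟨y, -, rfl⟩ := he
  have := (closure_component_subset hΓ hW y hx).resolve_right hxW
  rw [connectedComponentIn_eq this]

theorem closure_component_mem_segments {x : Γ} (hxW : x ∉ W) :
    closure (connectedComponentIn Wᶜ x) ∈ segments W := ⟨x, hxW, rfl⟩

theorem mem_closure_component {x : Γ} (hxW : x ∉ W) :
    x ∈ closure (connectedComponentIn Wᶜ x) :=
  subset_closure (mem_connectedComponentIn hxW)

theorem exists_segment_of_notMem (hW : IsVertexSet W) {x : Γ} (hxW : x ∉ W) :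
    ∃ e ∈ segments W, x ∈ e ∧ ∃ L s, IsParam e L s :=
  ⟨_, closure_component_mem_segments hxW, mem_closure_component hxW,
    hW.segment _ (closure_component_mem_segments hxW)⟩

theorem segment_eq_of_mem (hΓ : IsMetrizedGraph Γ) (hW : IsVertexSet W) (he : e ∈ segments W)
    (he' : e' ∈ segments W) {x : Γ} (hx : x ∈ e) (hx' : x ∈ e') (hxW : x ∉ W) : e = e' := by
  rw [eq_closure_of_mem hΓ hW he hx hxW, eq_closure_of_mem hΓ hW he' hx' hxW]

/-- A segment with an end in each of two given vertices is unique: there are no multiple edges. -/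
theorem segment_eq_of_two_mem (hW : IsVertexSet W) (he : e ∈ segments W)
    (he' : e' ∈ segments W) {p q : Γ} (hpq : p ≠ q) (hp : p ∈ e) (hp' : p ∈ e') (hq : q ∈ e)
    (hq' : q ∈ e') : e = e' := by
  by_contra hne
  rcases hW.inter e he e' he' hne with h | ⟨z, h, -⟩
  · exact (h ▸ (⟨hp, hp'⟩ : p ∈ e ∩ e') : p ∈ (∅ : Set Γ))
  · have h1 : p ∈ ({z} : Set Γ) := h ▸ (⟨hp, hp'⟩ : p ∈ e ∩ e')
    have h2 : q ∈ ({z} : Set Γ) := h ▸ (⟨hq, hq'⟩ : q ∈ e ∩ e')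
    exact hpq (h1.trans h2.symm)

/-- If the open segment `s '' (0, L)` is open in `Γ` and avoids `W`, while its ends are in `W`,
then `s '' [0, L]` is one of the segments cut out by `W`. -/
theorem mem_segments_of_param (hp : IsParam e L s) (hopen : IsOpen (s '' Ioo 0 L))
    (hsub : s '' Ioo 0 L ⊆ Wᶜ) (h0 : s 0 ∈ W) (hL : s L ∈ W) :
    e ∈ segments W ∧ ∀ x ∈ s '' Ioo 0 L, closure (connectedComponentIn Wᶜ x) = e := by
  have hpre : IsPreconnected (s '' Ioo 0 L) :=
    isPreconnected_Ioo.image _ (hp.continuousOn.mono Ioo_subset_Icc_self)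
  have hcl1 : closure (s '' Ioo 0 L) ⊆ e :=
    closure_minimal (by rw [hp.image_Ioo]; exact sdiff_subset) hp.isClosed
  have hbd : closure (s '' Ioo 0 L) ⊆ s '' Ioo 0 L ∪ W := by
    intro z hz
    rw [hp.image_Ioo]
    by_cases h : z ∈ ({s 0, s L} : Set Γ)
    · right
      rcases h with rfl | rfl
      · exact h0
      · exact hL
    · exact Or.inl ⟨hcl1 hz, h⟩
  have hcl : closure (s '' Ioo 0 L) = e := by
    refine Subset.antisymm hcl1 ?_
    have hc : ContinuousOn s (closure (Ioo 0 L)) := by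
      rw [closure_Ioo hp.pos.ne]; exact hp.continuousOn
    have := hc.image_closure
    rwa [closure_Ioo hp.pos.ne, hp.image_eq] at this
  have hall : ∀ x ∈ s '' Ioo 0 L, closure (connectedComponentIn Wᶜ x) = e := by
    intro x hx
    rw [connectedComponentIn_compl_eq hopen hpre hsub hbd hx, hcl]
  refine ⟨?_, hall⟩
  have hm : s (L / 2) ∈ s '' Ioo 0 L :=
    mem_image_of_mem _ ⟨by linarith [hp.pos], by linarith [hp.pos]⟩
  exact ⟨_, hsub hm, (hall _ hm).symm⟩

/-! ### The arms at a point and the segments -/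

variable {p : Γ} {n : ℕ} {r : ℝ} {φ : Fin n → ℝ → Γ}

/-- Near `p`, an arm avoids the vertex set, except possibly at `p` itself. -/
theorem exists_arm_notMem (hW : IsVertexSet W) (h : IsStarChart p n r φ) :
    ∃ ε > 0, ε ≤ r ∧ IsStarChart p n ε φ ∧ ∀ k, ∀ t ∈ Ioo 0 ε, φ k t ∉ W := by
  have hU : (W \ {p})ᶜ ∈ 𝓝 p :=
    (hW.finite.subset sdiff_subset).isClosed.isOpen_compl.mem_nhds (by simp)
  obtain ⟨ε, hε, hεr, h', hmem⟩ := h.exists_mono hU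
  refine ⟨ε, hε, hεr, h', fun k t ht hWt => hmem k t ⟨ht.1.le, ht.2⟩ ⟨hWt, ?_⟩⟩
  intro hpt
  have := h'.dist_center k (a := t) ⟨ht.1.le, ht.2⟩
  rw [mem_singleton_iff.1 hpt, dist_self] at this
  exact ht.1.ne this

/-- An arm that avoids `W` runs inside a single segment. -/
theorem exists_segment_of_arm (h : IsStarChart p n r φ) (k : Fin n)
    (hav : ∀ t ∈ Ioo 0 r, φ k t ∉ W) :
    ∃ e ∈ segments W, (∀ t ∈ Ioo 0 r, closure (connectedComponentIn Wᶜ (φ k t)) = e) ∧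
      ∀ t ∈ Ico 0 r, φ k t ∈ e := by
  have hr := h.r_pos
  have hmid : r / 2 ∈ Ioo 0 r := ⟨by linarith, by linarith⟩
  have hpre : IsPreconnected (φ k '' Ioo 0 r) :=
    isPreconnected_Ioo.image _ ((h.continuousOn k).mono Ioo_subset_Ico_self)
  have hsub : φ k '' Ioo 0 r ⊆ Wᶜ := by rintro _ ⟨t, ht, rfl⟩; exact hav t ht
  have hC := hpre.subset_connectedComponentIn (mem_image_of_mem _ hmid) hsub
  refine ⟨closure (connectedComponentIn Wᶜ (φ k (r / 2))),
    closure_component_mem_segments (hav _ hmid), ?_, ?_⟩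
  · intro t ht
    rw [connectedComponentIn_eq (hC (mem_image_of_mem _ ht))]
  · intro t ht
    rcases ht.1.eq_or_lt with rfl | h0
    · have hcw : ContinuousWithinAt (φ k) (Ioo 0 r) 0 :=
        ((h.continuousOn k) 0 ht).mono Ioo_subset_Ico_self
      refine closure_mono hC (hcw.mem_closure_image ?_)
      rw [closure_Ioo hr.ne]; exact ⟨le_rfl, hr.le⟩
    · exact subset_closure (hC (mem_image_of_mem _ ⟨h0, ht.2⟩))

/-- Near `p`, every arm follows a segment in arc length, starting from the coordinate of `p`. -/
theorem exists_arm_param (hΓ : IsMetrizedGraph Γ) (hW : IsVertexSet W)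
    (h : IsStarChart p n r φ) (k : Fin n) :
    ∃ e ∈ segments W, ∃ L s, IsParam e L s ∧ ∃ t₀ ∈ Ico 0 L, s t₀ = p ∧ (p ∈ W → t₀ = 0) ∧
      ∃ ε > 0, ∀ t ∈ Ico 0 ε, t₀ + t ∈ Icc 0 L ∧ φ k t = s (t₀ + t) := by
  obtain ⟨ε, hε, -, h', hav⟩ := exists_arm_notMem hW h
  obtain ⟨e, he, -, hmem⟩ := exists_segment_of_arm h' k (hav k)
  obtain ⟨L, s, hs⟩ := hW.segment e he
  have main : ∃ s, IsParam e L s ∧ ∃ t₀ ∈ Icc 0 L,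
      ∀ t ∈ Ico 0 ε, t₀ + t ∈ Icc 0 L ∧ φ k t = s (t₀ + t) := by
    obtain ⟨t₀, ht₀, H | H⟩ := hs.eq_translate (I := Ico 0 ε) ⟨le_rfl, hε⟩ (h'.dist_same k) hmem
    · exact ⟨s, hs, t₀, ht₀, H⟩
    · refine ⟨_, hs.reverse, L - t₀, ⟨by linarith [ht₀.2], by linarith [ht₀.1]⟩, ?_⟩
      intro t ht
      obtain ⟨h1, h2⟩ := H t ht
      refine ⟨⟨by linarith [h1.2], by linarith [h1.1]⟩, ?_⟩
      rw [h2]; congr 1; ring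
  obtain ⟨σ, hσ, t₀, ht₀, H⟩ := main
  have hp : σ t₀ = p := by
    have := (H 0 ⟨le_rfl, hε⟩).2
    rw [h.center, add_zero] at this
    exact this.symm
  have hlt : t₀ < L := by
    have := (H (ε / 2) ⟨by linarith, by linarith⟩).1.2
    linarith
  refine ⟨e, he, L, σ, hσ, t₀, ⟨ht₀.1, hlt⟩, hp, fun hpW => ?_, ε, hε, H⟩
  by_contra hne
  exact apply_notMem hΓ hW he hσ ⟨ht₀.1.lt_of_ne (Ne.symm hne), hlt⟩ (hp ▸ hpW)

end Segments

/-! ### The graph with vertex set `W` -/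

section Graph

variable {Γ : Type*} [MetricSpace Γ] {W : Set Γ} {e e' : Set Γ} {L L' : ℝ} {s s' : ℝ → Γ}
variable {p q x : Γ} {n : ℕ} {r : ℝ} {φ : Fin n → ℝ → Γ}

theorem IsParam.eq_of_zero_eq (h : IsParam e L s) (h' : IsParam e L' s') (h0 : s' 0 = s 0) :
    L' = L ∧ ∀ t ∈ Icc 0 L, s' t = s t := by
  obtain ⟨rfl, H | H⟩ := h.eq_or_reverse h'
  · exact ⟨rfl, H⟩
  · have := H 0 h.zero_mem
    rw [h0, sub_zero] at this
    exact absurd this h.ends_ne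

/-- `p` and `q` are the two ends of a segment cut out by `W`. -/
def Adj (W : Set Γ) (p q : Γ) : Prop :=
  ∃ e ∈ segments W, ∃ L s, IsParam e L s ∧ s 0 = p ∧ s L = q

theorem Adj.symm (h : Adj W p q) : Adj W q p := by
  obtain ⟨e, he, L, s, hs, rfl, rfl⟩ := h
  exact ⟨e, he, L, _, hs.reverse, by simp, by simp⟩

theorem Adj.ne (h : Adj W p q) : p ≠ q := by
  obtain ⟨e, -, L, s, hs, rfl, rfl⟩ := h
  exact hs.ends_ne

theorem Adj.left_mem (hΓ : IsMetrizedGraph Γ) (hW : IsVertexSet W) (h : Adj W p q) : p ∈ W := by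
  obtain ⟨e, he, L, s, hs, rfl, rfl⟩ := h
  exact (ends_mem hΓ hW he hs).1

theorem Adj.right_mem (hΓ : IsMetrizedGraph Γ) (hW : IsVertexSet W) (h : Adj W p q) : q ∈ W :=
  h.symm.left_mem hΓ hW

/-- The arms at a vertex correspond to its neighbours: each arm starts along the segment that
leads to one of them. -/
theorem exists_arm_equiv_neighbours (hΓ : IsMetrizedGraph Γ) (hW : IsVertexSet W) (hpW : p ∈ W)
    (h : IsStarChart p n r φ) :
    ∃ q : Fin n → Γ, Function.Injective q ∧ (∀ x, Adj W p x → ∃ k, q k = x) ∧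
      ∀ k, ∃ e ∈ segments W, ∃ L s, IsParam e L s ∧ s 0 = p ∧ s L = q k ∧
        ∃ ε > 0, ∀ t ∈ Ico 0 ε, t ∈ Icc 0 L ∧ φ k t = s t := by
  have H := fun k => exists_arm_param hΓ hW h k
  choose e he L s hs t₀ ht₀ hpt h0 ε hε hφ using H
  have ht0 : ∀ k, t₀ k = 0 := fun k => h0 k hpW
  simp only [ht0, zero_add] at hpt hφ
  refine ⟨fun k => s k (L k), ?_, ?_, fun k =>
    ⟨e k, he k, L k, s k, hs k, hpt k, rfl, ε k, hε k, hφ k⟩⟩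
  · intro k l hkl
    simp only at hkl
    by_contra hne
    have hpq : p ≠ s k (L k) := by rw [← hpt k]; exact (hs k).ends_ne
    have hee : e k = e l := by
      refine segment_eq_of_two_mem hW (he k) (he l) hpq ?_ ?_
        ((hs k).apply_mem (hs k).length_mem) (hkl ▸ (hs l).apply_mem (hs l).length_mem)
      · exact hpt k ▸ (hs k).apply_mem (hs k).zero_mem
      · exact hpt l ▸ (hs l).apply_mem (hs l).zero_mem
    obtain ⟨-, hst⟩ := (hs k).eq_of_zero_eq (hee ▸ hs l) ((hpt l).trans (hpt k).symm)
    set δ := min (min (ε k) (ε l)) r / 2 with hδ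
    have hm : 0 < min (min (ε k) (ε l)) r := lt_min (lt_min (hε k) (hε l)) h.r_pos
    have hδ0 : 0 < δ := by positivity
    have hlt : δ < min (min (ε k) (ε l)) r := by rw [hδ]; linarith
    have h1 : δ < ε k := hlt.trans_le ((min_le_left _ _).trans (min_le_left _ _))
    have h2 : δ < ε l := hlt.trans_le ((min_le_left _ _).trans (min_le_right _ _))
    have h3 : δ < r := hlt.trans_le (min_le_right _ _)
    have := h.dist_ne k l hne δ ⟨hδ0.le, h3⟩ δ ⟨hδ0.le, h3⟩
    rw [(hφ k δ ⟨hδ0.le, h1⟩).2, (hφ l δ ⟨hδ0.le, h2⟩).2,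
      hst δ (hφ k δ ⟨hδ0.le, h1⟩).1, dist_self] at this
    linarith
  · rintro x ⟨E, hE, l, σ, hσ, hσ0, rfl⟩
    have hcont : Tendsto σ (𝓝[>] 0) (𝓝 p) := by
      have h1 : Tendsto σ (𝓝[Icc 0 l] 0) (𝓝 p) := by
        have := hσ.continuousOn 0 hσ.zero_mem
        rwa [ContinuousWithinAt, hσ0] at this
      refine h1.mono_left (nhdsWithin_le_iff.2 ?_)
      filter_upwards [Ioo_mem_nhdsGT hσ.pos] with t ht using Ioo_subset_Icc_self ht
    have hev : ∀ᶠ t in 𝓝[>] (0 : ℝ), (∀ k, t < ε k) ∧ σ t ∈ (⋃ k, φ k '' Ico 0 r) ∧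
        t ∈ Ioo 0 l := by
      refine (eventually_all.2 fun k => ?_).and
        ((hcont.eventually h.nhds).and (Ioo_mem_nhdsGT hσ.pos))
      filter_upwards [Ioo_mem_nhdsGT (hε k)] with t ht using ht.2
    obtain ⟨t, htε, hst, ht⟩ := hev.exists
    obtain ⟨k, a, ha, hka⟩ := mem_iUnion.1 hst
    have hat : a = t := by
      rw [← h.dist_center k ha, hka, ← hσ0, hσ.dist_left (Ioo_subset_Icc_self ht)]
    subst hat
    obtain ⟨hm, hs'⟩ := hφ k a ⟨ht.1.le, htε k⟩
    have hee : E = e k := by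
      refine segment_eq_of_mem hΓ hW hE (he k) (hσ.apply_mem (Ioo_subset_Icc_self ht)) ?_
        (apply_notMem hΓ hW hE hσ ht)
      rw [← hka, hs']; exact (hs k).apply_mem hm
    obtain ⟨h1, h2⟩ := (hs k).eq_of_zero_eq (hee ▸ hσ) (hσ0.trans (hpt k).symm)
    exact ⟨k, by simp only; rw [h1, h2 _ (hs k).length_mem]⟩

open Classical in
/-- The neighbours of `p` in the graph with vertex set `W`. -/
def neighbours (hW : IsVertexSet W) (p : Γ) : Finset Γ :=
  hW.finite.toFinset.filter (Adj W p)

theorem mem_neighbours (hΓ : IsMetrizedGraph Γ) (hW : IsVertexSet W) :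
    q ∈ neighbours hW p ↔ Adj W p q := by
  simp only [neighbours, Finset.mem_filter, Finite.mem_toFinset, and_iff_right_iff_imp]
  exact fun h => h.right_mem hΓ hW

/-- At a vertex, sums over the directions are sums over the neighbours. -/
theorem slopeSum_eq_sum_neighbours (hΓ : IsMetrizedGraph Γ) (hW : IsVertexSet W) (hpW : p ∈ W)
    {f : Γ → ℝ} (m : Γ → ℝ)
    (hm : ∀ e ∈ segments W, ∀ L s, IsParam e L s → s 0 = p →
      HasDerivWithinAt (fun t => f (s t)) (m (s L)) (Ici 0) 0) :
    slopeSum f p = ∑ q ∈ neighbours hW p, m q ∧ valence p = (neighbours hW p).card := by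
  classical
  obtain ⟨r, h⟩ := exists_isStarChart_arm hΓ p
  obtain ⟨q, hinj, hsurj, hq⟩ := exists_arm_equiv_neighbours hΓ hW hpW h
  have himg : neighbours hW p = Finset.univ.image q := by
    ext x
    rw [mem_neighbours hΓ hW, Finset.mem_image]
    constructor
    · intro hx
      obtain ⟨k, hk⟩ := hsurj x hx
      exact ⟨k, Finset.mem_univ _, hk⟩
    · rintro ⟨k, -, rfl⟩
      obtain ⟨e, he, L, s, hs, h0, h1, -⟩ := hq k
      exact ⟨e, he, L, s, hs, h0, h1⟩
  have hder : ∀ k, HasDerivWithinAt (fun t => f (arm p k t)) (m (q k)) (Ici 0) 0 := by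
    intro k
    obtain ⟨e, he, L, s, hs, h0, h1, ε, hε, hst⟩ := hq k
    refine (h1 ▸ hm e he L s hs h0).congr_of_eventuallyEq ?_ ?_
    · filter_upwards [Ico_mem_nhdsGE hε] with t ht
      rw [(hst t ht).2]
    · rw [(hst 0 ⟨le_rfl, hε⟩).2]
  refine ⟨?_, ?_⟩
  · rw [himg, Finset.sum_image (fun a _ b _ hab => hinj hab), slopeSum]
    refine Finset.sum_congr rfl fun k _ => ?_
    exact (hder k).derivWithin (uniqueDiffOn_Ici 0 0 self_mem_Ici)
  · rw [himg, Finset.card_image_of_injective _ hinj, Finset.card_univ, Fintype.card_fin]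

/-- Outside the vertex set the two arms are the two directions of a segment. -/
theorem exists_opposite_arms (hΓ : IsMetrizedGraph Γ) (hW : IsVertexSet W) (hpW : p ∉ W) :
    ∃ e ∈ segments W, ∃ L s, IsParam e L s ∧ ∃ t₀ ∈ Ioo 0 L, s t₀ = p ∧
      ∃ k₀ k₁ : Fin (valence p), k₀ ≠ k₁ ∧ Finset.univ = {k₀, k₁} ∧
        ∃ ε > 0, ∀ t ∈ Ico 0 ε, t₀ + t ∈ Icc 0 L ∧ t₀ - t ∈ Icc 0 L ∧
          arm p k₀ t = s (t₀ + t) ∧ arm p k₁ t = s (t₀ - t) := by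
  have h2 : valence p = 2 := by
    by_contra h
    exact hpW (hW.valence_ne_two p h)
  obtain ⟨r, h⟩ := exists_isStarChart_arm hΓ p
  set k₀ : Fin (valence p) := ⟨0, by omega⟩ with hk₀
  set k₁ : Fin (valence p) := ⟨1, by omega⟩ with hk₁
  have hne : k₀ ≠ k₁ := by simp [hk₀, hk₁]
  obtain ⟨e, he, L, s, hs, t₀, ht₀, hst₀, -, ε₀, hε₀, H₀⟩ := exists_arm_param hΓ hW h k₀
  obtain ⟨e', he', L', s', hs', t₁, ht₁, hst₁, -, ε₁, hε₁, H₁⟩ := exists_arm_param hΓ hW h k₁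
  obtain rfl : e = e' := segment_eq_of_mem hΓ hW he he'
    (hst₀ ▸ hs.apply_mem (Ico_subset_Icc_self ht₀))
    (hst₁ ▸ hs'.apply_mem (Ico_subset_Icc_self ht₁)) hpW
  have ht₀' : t₀ ∈ Ioo 0 L := by
    refine ⟨ht₀.1.lt_of_ne ?_, ht₀.2⟩
    rintro rfl
    exact hpW (hst₀ ▸ (ends_mem hΓ hW he hs).1)
  refine ⟨e, he, L, s, hs, t₀, ht₀', hst₀, k₀, k₁, hne, ?_, min ε₀ ε₁, lt_min hε₀ hε₁, ?_⟩
  · ext k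
    simp only [Finset.mem_univ, Finset.mem_insert, Finset.mem_singleton, true_iff, hk₀, hk₁,
      Fin.ext_iff]
    omega
  obtain ⟨rfl, hcase⟩ := hs.eq_or_reverse hs'
  have ht₁' := Ico_subset_Icc_self ht₁
  rcases hcase with hcase | hcase
  · exfalso
    have h01 : t₁ = t₀ := by
      refine hs.injOn ht₁' (Ico_subset_Icc_self ht₀) ?_
      rw [← hcase _ ht₁', hst₁, hst₀]
    subst h01
    have hm : 0 < min (min ε₀ ε₁) r := lt_min (lt_min hε₀ hε₁) h.r_pos
    set δ := min (min ε₀ ε₁) r / 2 with hδ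
    have hδ0 : 0 < δ := by positivity
    have hlt : δ < min (min ε₀ ε₁) r := by rw [hδ]; linarith
    have h1 : δ < ε₀ := hlt.trans_le ((min_le_left _ _).trans (min_le_left _ _))
    have h2 : δ < ε₁ := hlt.trans_le ((min_le_left _ _).trans (min_le_right _ _))
    have h3 : δ < r := hlt.trans_le (min_le_right _ _)
    have := h.dist_ne k₀ k₁ hne δ ⟨hδ0.le, h3⟩ δ ⟨hδ0.le, h3⟩
    rw [(H₀ δ ⟨hδ0.le, h1⟩).2, (H₁ δ ⟨hδ0.le, h2⟩).2, hcase _ (H₁ δ ⟨hδ0.le, h2⟩).1,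
      dist_self] at this
    linarith
  · have h01 : L' - t₁ = t₀ := by
      refine hs.injOn ⟨by linarith [ht₁.2], by linarith [ht₁.1]⟩ (Ico_subset_Icc_self ht₀) ?_
      rw [← hcase _ ht₁', hst₁, hst₀]
    intro t ht
    obtain ⟨ha, hb⟩ := H₀ t ⟨ht.1, ht.2.trans_le (min_le_left _ _)⟩
    obtain ⟨hc, hd⟩ := H₁ t ⟨ht.1, ht.2.trans_le (min_le_right _ _)⟩
    refine ⟨ha, ⟨by linarith [hc.2], by linarith [hc.1]⟩, hb, ?_⟩
    rw [hd, hcase _ hc, ← h01]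
    congr 1; ring

/-- There are at most as many segments as pairs of vertices. -/
theorem segments_finite (hΓ : IsMetrizedGraph Γ) (hW : IsVertexSet W) : (segments W).Finite := by
  have hsub : segments W ⊆ ⋃ pq ∈ W ×ˢ W,
      {e | e ∈ segments W ∧ pq.1 ≠ pq.2 ∧ pq.1 ∈ e ∧ pq.2 ∈ e} := by
    intro e he
    obtain ⟨L, s, hs⟩ := hW.segment e he
    obtain ⟨h0, h1⟩ := ends_mem hΓ hW he hs
    exact mem_biUnion (show (s 0, s L) ∈ W ×ˢ W from ⟨h0, h1⟩)
      ⟨he, hs.ends_ne, hs.apply_mem hs.zero_mem, hs.apply_mem hs.length_mem⟩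
  refine ((hW.finite.prod hW.finite).biUnion fun pq _ => Set.Subsingleton.finite ?_).subset hsub
  rintro e ⟨he, hne, h1, h2⟩ e' ⟨he', -, h1', h2'⟩
  exact segment_eq_of_two_mem hW he he' hne h1 h1' h2 h2'

/-- The segments cover the graph. -/
theorem exists_segment_of_mem (hΓ : IsMetrizedGraph Γ) (hW : IsVertexSet W) (x : Γ) :
    ∃ e ∈ segments W, x ∈ e := by
  by_cases hx : x ∈ W
  · obtain ⟨r, h⟩ := exists_isStarChart_arm hΓ x
    obtain ⟨e, he, L, s, hs, t₀, ht₀, hst, -⟩ := exists_arm_param hΓ hW h ⟨0, h.one_le⟩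
    exact ⟨e, he, hst ▸ hs.apply_mem (Ico_subset_Icc_self ht₀)⟩
  · obtain ⟨e, he, hxe, -⟩ := exists_segment_of_notMem hW hx
    exact ⟨e, he, hxe⟩

/-! ### Subdivision -/

theorem isOpen_image_Ioo_left (hΓ : IsMetrizedGraph Γ) (hW : IsVertexSet W)
    (he : e ∈ segments W) (hs : IsParam e L s) {t : ℝ} (ht : t ∈ Ioo 0 L) :
    IsOpen (s '' Ioo 0 t) := by
  have : s '' Ioo 0 t = s '' Ioo 0 L ∩ {z | dist z (s 0) < t} := by
    ext z
    constructor
    · rintro ⟨u, hu, rfl⟩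
      have huL : u ∈ Ioo 0 L := ⟨hu.1, hu.2.trans ht.2⟩
      refine ⟨mem_image_of_mem _ huL, ?_⟩
      rw [mem_ofPred_eq, hs.dist_left (Ioo_subset_Icc_self huL)]
      exact hu.2
    · rintro ⟨⟨u, hu, rfl⟩, h⟩
      rw [mem_ofPred_eq, hs.dist_left (Ioo_subset_Icc_self hu)] at h
      exact ⟨u, ⟨hu.1, h⟩, rfl⟩
  rw [this]
  exact (isOpen_image_Ioo hΓ hW he hs).inter
    (isOpen_lt (continuous_id.dist continuous_const) continuous_const)

/-- A new vertex cuts the segment on which it lies in two. -/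
theorem subsegment_mem_segments_insert (hΓ : IsMetrizedGraph Γ) (hW : IsVertexSet W)
    (he : e ∈ segments W) (hs : IsParam e L s) {t : ℝ} (ht : t ∈ Ioo 0 L) (hx : s t = x) :
    s '' Icc 0 t ∈ segments (insert x W) ∧
      ∀ z ∈ s '' Ioo 0 t, closure (connectedComponentIn (insert x W)ᶜ z) = s '' Icc 0 t := by
  refine mem_segments_of_param (hs.subinterval ⟨ht.1, ht.2.le⟩)
    (isOpen_image_Ioo_left hΓ hW he hs ht) ?_
    (mem_insert_of_mem _ (ends_mem hΓ hW he hs).1) (by rw [hx]; exact mem_insert _ _)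
  rintro _ ⟨u, hu, rfl⟩ (H | H)
  · have := hs.injOn ⟨hu.1.le, (hu.2.trans ht.2).le⟩ (Ioo_subset_Icc_self ht) (H.trans hx.symm)
    exact hu.2.ne this
  · exact apply_notMem hΓ hW he hs ⟨hu.1, hu.2.trans ht.2⟩ H

theorem segments_insert_subset (hΓ : IsMetrizedGraph Γ) (hW : IsVertexSet W)
    (he : e ∈ segments W) (hs : IsParam e L s) {t : ℝ} (ht : t ∈ Ioo 0 L) (hx : s t = x)
    (he' : e' ∈ segments (insert x W)) :
    (e' ∈ segments W ∧ e' ≠ e) ∨ e' = s '' Icc 0 t ∨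
      e' = (fun u => s (L - u)) '' Icc 0 (L - t) := by
  have hxW : x ∉ W := hx ▸ apply_notMem hΓ hW he hs ht
  obtain ⟨z, hz, rfl⟩ := he'
  rw [mem_compl_iff, mem_insert_iff, not_or] at hz
  obtain ⟨E, hE, hzE, l, σ, hσ⟩ := exists_segment_of_notMem hW hz.2
  by_cases hEe : E = e
  · right
    subst hEe
    obtain ⟨u, hu, rfl⟩ := mem_image_Ioo_of_notMem hΓ hW he hs hzE hz.2
    rcases lt_trichotomy u t with h | rfl | h
    · left
      exact (subsegment_mem_segments_insert hΓ hW he hs ht hx).2 _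
        (mem_image_of_mem _ ⟨hu.1, h⟩)
    · exact absurd hx hz.1
    · right
      refine (subsegment_mem_segments_insert hΓ hW he hs.reverse (t := L - t)
        ⟨by linarith [ht.2], by linarith [ht.1]⟩ (by simpa using hx)).2 _
        ⟨L - u, ⟨by linarith [hu.2], by linarith⟩, by simp⟩
  · left
    have hxE : x ∉ E := fun hxE => hEe (segment_eq_of_mem hΓ hW hE he hxE
      (hx ▸ hs.apply_mem (Ioo_subset_Icc_self ht)) hxW)
    obtain ⟨h0, h1⟩ := ends_mem hΓ hW hE hσ
    have := (mem_segments_of_param (W := insert x W) hσ (isOpen_image_Ioo hΓ hW hE hσ) (by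
      intro y hy
      rintro (rfl | H)
      · exact hxE (by rw [hσ.image_Ioo] at hy; exact hy.1)
      · exact image_Ioo_subset_compl hΓ hW hE hσ hy H) (mem_insert_of_mem _ h0)
        (mem_insert_of_mem _ h1)).2 z (mem_image_Ioo_of_notMem hΓ hW hE hσ hzE hz.2)
    rw [this]
    exact ⟨hE, hEe⟩

/-- The condition on two different segments in the definition of vertex sets. -/
def MeetsProperly (e e' : Set Γ) : Prop :=
  e ∩ e' = ∅ ∨ ∃ p, e ∩ e' = {p} ∧ IsEndpoint e p ∧ IsEndpoint e' p

theorem MeetsProperly.symm (h : MeetsProperly e e') : MeetsProperly e' e := by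
  rcases h with h | ⟨p, h, h1, h2⟩
  · exact Or.inl (by rwa [inter_comm])
  · exact Or.inr ⟨p, by rwa [inter_comm], h2, h1⟩

theorem MeetsProperly.subsegment (h : MeetsProperly e e') (hs : IsParam e L s) {t : ℝ}
    (ht : t ∈ Ioo 0 L) : MeetsProperly (s '' Icc 0 t) e' := by
  have hsub : s '' Icc 0 t ⊆ e := by
    rw [← hs.image_eq]; exact image_mono (Icc_subset_Icc_right ht.2.le)
  have hs' := hs.subinterval ⟨ht.1, ht.2.le⟩
  rcases h with h | ⟨p, h, h1, h2⟩
  · exact Or.inl (subset_empty_iff.1 (h ▸ inter_subset_inter_left _ hsub))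
  · by_cases hp : p ∈ s '' Icc 0 t
    · have hp0 : p = s 0 := by
        refine (hs.isEndpoint_iff.1 h1).resolve_right ?_
        rintro rfl
        obtain ⟨u, hu, hus⟩ := hp
        have := hs.injOn ⟨hu.1, hu.2.trans ht.2.le⟩ hs.length_mem hus
        linarith [hu.2, ht.2]
      refine Or.inr ⟨p, ?_, hs'.isEndpoint_iff.2 (Or.inl hp0), h2⟩
      refine Subset.antisymm (h ▸ inter_subset_inter_left _ hsub) ?_
      have : p ∈ e ∩ e' := by rw [h]; rfl
      exact singleton_subset_iff.2 ⟨hp, this.2⟩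
    · left
      refine eq_empty_of_forall_notMem fun z hz => hp ?_
      have : z ∈ ({p} : Set Γ) := h ▸ inter_subset_inter_left _ hsub hz
      rw [mem_singleton_iff] at this
      exact this ▸ hz.1

theorem meetsProperly_halves (hs : IsParam e L s) {t : ℝ} (ht : t ∈ Ioo 0 L) :
    MeetsProperly (s '' Icc 0 t) ((fun u => s (L - u)) '' Icc 0 (L - t)) := by
  have ht' : L - t ∈ Ioc 0 L := ⟨by linarith [ht.2], by linarith [ht.1]⟩
  refine Or.inr ⟨s t, ?_, (hs.subinterval ⟨ht.1, ht.2.le⟩).isEndpoint_iff.2 (Or.inr rfl),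
    (hs.reverse.subinterval ht').isEndpoint_iff.2 (Or.inr (by simp))⟩
  refine Subset.antisymm ?_ ?_
  · rintro _ ⟨⟨u, hu, rfl⟩, v, hv, huv⟩
    have := hs.injOn (x₁ := L - v) ⟨by linarith [hv.2, ht.1], by linarith [hv.1]⟩
      ⟨hu.1, hu.2.trans ht.2.le⟩ huv
    have : u = t := by linarith [hu.2, hv.2]
    rw [this]; rfl
  · rintro _ rfl
    exact ⟨⟨t, ⟨ht.1.le, le_rfl⟩, rfl⟩, L - t, ⟨ht'.1.le, le_rfl⟩, by simp⟩

theorem IsVertexSet.insert (hΓ : IsMetrizedGraph Γ) (hW : IsVertexSet W) (x : Γ) :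
    IsVertexSet (insert x W) := by
  by_cases hxW : x ∈ W
  · rwa [insert_eq_of_mem hxW]
  obtain ⟨e, he, hxe, L, s, hs⟩ := exists_segment_of_notMem hW hxW
  obtain ⟨t, ht, hx⟩ := mem_image_Ioo_of_notMem hΓ hW he hs hxe hxW
  have ht' : L - t ∈ Ioo 0 L := ⟨by linarith [ht.2], by linarith [ht.1]⟩
  have hcl := fun e' (he' : e' ∈ segments (Insert.insert x W)) =>
    segments_insert_subset hΓ hW he hs ht hx he'
  refine ⟨hW.finite.insert x, insert_nonempty _ _,
    fun p hp => mem_insert_of_mem _ (hW.valence_ne_two p hp), ?_, ?_⟩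
  · intro e' he'
    rcases hcl e' he' with ⟨h, -⟩ | rfl | rfl
    · exact hW.segment e' h
    · exact ⟨_, _, hs.subinterval ⟨ht.1, ht.2.le⟩⟩
    · exact ⟨_, _, hs.reverse.subinterval ⟨ht'.1, ht'.2.le⟩⟩
  · intro e₁ h₁ e₂ h₂ hne
    change MeetsProperly e₁ e₂
    have hold : ∀ E ∈ segments W, E ≠ e → MeetsProperly e E := fun E hE hEe =>
      hW.inter e he E hE hEe.symm
    rcases hcl e₁ h₁ with ⟨h1, h1e⟩ | rfl | rfl <;> rcases hcl e₂ h₂ with ⟨h2, h2e⟩ | rfl | rfl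
    · exact hW.inter _ h1 _ h2 hne
    · exact ((hold _ h1 h1e).subsegment hs ht).symm
    · exact ((hold _ h1 h1e).subsegment hs.reverse ht').symm
    · exact (hold _ h2 h2e).subsegment hs ht
    · exact absurd rfl hne
    · exact meetsProperly_halves hs ht
    · exact (hold _ h2 h2e).subsegment hs.reverse ht'
    · exact (meetsProperly_halves hs ht).symm
    · exact absurd rfl hne

theorem neighbours_insert (hΓ : IsMetrizedGraph Γ) (hW : IsVertexSet W)
    (he : e ∈ segments W) (hs : IsParam e L s) {t : ℝ} (ht : t ∈ Ioo 0 L) [DecidableEq Γ] :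
    neighbours (hW.insert hΓ (s t)) (s t) = {s 0, s L} := by
  have ht' : L - t ∈ Ioo 0 L := ⟨by linarith [ht.2], by linarith [ht.1]⟩
  have h₁ := (hs.subinterval ⟨ht.1, ht.2.le⟩).reverse
  have h₂ := (hs.reverse.subinterval ⟨ht'.1, ht'.2.le⟩).reverse
  ext q
  rw [mem_neighbours hΓ, Finset.mem_insert, Finset.mem_singleton]
  constructor
  · rintro ⟨E, hE, l, σ, hσ, h0, rfl⟩
    rcases segments_insert_subset hΓ hW he hs ht rfl hE with ⟨hE', -⟩ | rfl | rfl
    · exact absurd (h0 ▸ (ends_mem hΓ hW hE' hσ).1) (apply_notMem hΓ hW he hs ht)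
    · left
      obtain ⟨rfl, H⟩ := h₁.eq_of_zero_eq hσ (by simpa using h0)
      simpa using H _ hσ.length_mem
    · right
      obtain ⟨rfl, H⟩ := h₂.eq_of_zero_eq hσ (by simpa using h0)
      simpa using H _ hσ.length_mem
  · rintro (rfl | rfl)
    · exact ⟨_, (subsegment_mem_segments_insert hΓ hW he hs ht rfl).1, _, _, h₁, by simp, by simp⟩
    · exact ⟨_, (subsegment_mem_segments_insert hΓ hW he hs.reverse ht' (by simp)).1, _, _, h₂,
        by simp, by simp⟩

end Graph

/-! ### Functions that are quadratic on each segment -/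

section Quadratic

theorem hasDerivAt_quadratic (A B C t : ℝ) :
    HasDerivAt (fun u : ℝ => A * u ^ 2 + B * u + C) (2 * A * t + B) t := by
  have := (((hasDerivAt_pow 2 t).const_mul A).add ((hasDerivAt_id t).const_mul B)).add_const C
  refine this.congr_deriv ?_
  norm_num; ring

theorem iteratedDeriv_two_quadratic (A B C t : ℝ) :
    iteratedDeriv 2 (fun u : ℝ => A * u ^ 2 + B * u + C) t = 2 * A := by
  have h1 : deriv (fun u : ℝ => A * u ^ 2 + B * u + C) = fun u => 0 * u ^ 2 + (2 * A) * u + B := by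
    ext u; rw [(hasDerivAt_quadratic A B C u).deriv]; ring
  rw [iteratedDeriv_succ, iteratedDeriv_one, h1, (hasDerivAt_quadratic 0 (2 * A) B t).deriv]
  ring

variable {Γ : Type*} [MetricSpace Γ] {W : Set Γ} {e : Set Γ} {L : ℝ} {s : ℝ → Γ}
variable {A : Set Γ → ℝ} {f : Γ → ℝ} {p : Γ}

theorem slopeSum_add_const_mul {f' : Γ → ℝ}
    (h : ∀ k, DifferentiableWithinAt ℝ (fun t => f (arm p k t)) (Ici 0) 0)
    (h' : ∀ k, DifferentiableWithinAt ℝ (fun t => f' (arm p k t)) (Ici 0) 0) (c : ℝ) :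
    slopeSum (fun x => f x + c * f' x) p = slopeSum f p + c * slopeSum f' p := by
  simp only [slopeSum, dirDeriv, Finset.mul_sum, ← Finset.sum_add_distrib]
  refine Finset.sum_congr rfl fun k _ => ?_
  rw [← derivWithin_const_mul c (h' k)]
  exact derivWithin_add (h k) ((h' k).const_mul c)

theorem slopeSum_const (c : ℝ) (p : Γ) : slopeSum (fun _ => c) p = 0 := by
  simp [slopeSum, dirDeriv]

/-- In arc length, `f` is a quadratic polynomial with leading coefficient `A e` on each segment `e`
cut out by `W`. The leading coefficient does not depend on the orientation of the segment. -/
def IsQuadratic (W : Set Γ) (A : Set Γ → ℝ) (f : Γ → ℝ) : Prop :=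
  ∀ e ∈ segments W, ∀ L s, IsParam e L s →
    ∃ B C : ℝ, ∀ t ∈ Icc 0 L, f (s t) = A e * t ^ 2 + B * t + C

/-- It is enough to have one parametrization of each segment. -/
theorem isQuadratic_of_exists_param (h : ∀ e ∈ segments W, ∃ L s, IsParam e L s ∧
    ∃ B C : ℝ, ∀ t ∈ Icc 0 L, f (s t) = A e * t ^ 2 + B * t + C) : IsQuadratic W A f := by
  intro e he L' s' hs'
  obtain ⟨L, s, hs, B, C, H⟩ := h e he
  obtain ⟨rfl, hcase | hcase⟩ := hs.eq_or_reverse hs'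
  · exact ⟨B, C, fun t ht => by rw [hcase t ht, H t ht]⟩
  · refine ⟨-2 * A e * L' - B, A e * L' ^ 2 + B * L' + C, fun t ht => ?_⟩
    rw [hcase t ht, H _ ⟨by linarith [ht.2], by linarith [ht.1]⟩]
    ring

theorem isQuadratic_const (W : Set Γ) (c : ℝ) : IsQuadratic W 0 fun _ => c :=
  fun _ _ _ _ _ => ⟨0, c, fun t _ => by simp⟩

namespace IsQuadratic

theorem add_const_mul {A' : Set Γ → ℝ} {f' : Γ → ℝ} (h : IsQuadratic W A f)
    (h' : IsQuadratic W A' f') (c : ℝ) :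
    IsQuadratic W (A + c • A') (fun x => f x + c * f' x) := by
  intro e he L s hs
  obtain ⟨B, C, H⟩ := h e he L s hs
  obtain ⟨B', C', H'⟩ := h' e he L s hs
  refine ⟨B + c * B', C + c * C', fun t ht => ?_⟩
  simp only [H t ht, H' t ht, Pi.add_apply, Pi.smul_apply, smul_eq_mul]
  ring

theorem continuous (hΓ : IsMetrizedGraph Γ) (hW : IsVertexSet W) (h : IsQuadratic W A f) :
    Continuous f := by
  have hfin := segments_finite hΓ hW
  have : Finite (segments W) := hfin
  refine (locallyFinite_of_finite (fun e : segments W => (e : Set Γ))).continuous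
    (eq_univ_of_forall fun x => ?_) (fun e => ?_) (fun e => ?_)
  · obtain ⟨e, he, hx⟩ := exists_segment_of_mem hΓ hW x
    exact mem_iUnion.2 ⟨⟨e, he⟩, hx⟩
  · obtain ⟨L, s, hs⟩ := hW.segment e e.2
    exact hs.isClosed
  · obtain ⟨L, s, hs⟩ := hW.segment e e.2
    obtain ⟨B, C, H⟩ := h e e.2 L s hs
    -- on the segment, `f` is a polynomial in the distance from an end
    have hc : Continuous fun x : Γ => A e * dist x (s 0) ^ 2 + B * dist x (s 0) + C := by fun_prop
    refine hc.continuousOn.congr fun x hx => ?_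
    conv_lhs => rw [← hs.apply_dist hx]
    rw [H _ (hs.dist_mem hx)]

theorem hasDerivWithinAt_zero (hs : IsParam e L s) {B C : ℝ}
    (H : ∀ t ∈ Icc 0 L, f (s t) = A e * t ^ 2 + B * t + C) :
    HasDerivWithinAt (fun t => f (s t)) B (Ici 0) 0 := by
  have := (hasDerivAt_quadratic (A e) B C 0).hasDerivWithinAt (s := Ici 0)
  rw [mul_zero, zero_add] at this
  refine this.congr_of_eventuallyEq ?_ (H 0 hs.zero_mem)
  filter_upwards [Ico_mem_nhdsGE hs.pos] with t ht using H t (Ico_subset_Icc_self ht)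

/-- The slope of `f` at the start of a segment is determined by the end values of `f`. -/
theorem hasDerivWithinAt_slope (h : IsQuadratic W A f) (he : e ∈ segments W)
    (hs : IsParam e L s) :
    HasDerivWithinAt (fun t => f (s t)) ((f (s L) - f (s 0)) / L - A e * L) (Ici 0) 0 := by
  obtain ⟨B, C, H⟩ := h e he L s hs
  refine (hasDerivWithinAt_zero hs H).congr_deriv ?_
  rw [H L hs.length_mem, H 0 hs.zero_mem]
  have := hs.pos.ne'
  field_simp
  ring

theorem apply_eq_interpolation (h : IsQuadratic W 0 f)
    (he : e ∈ segments W) (hs : IsParam e L s) {t : ℝ} (ht : t ∈ Icc 0 L) :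
    f (s t) = ((L - t) * f (s 0) + t * f (s L)) / L := by
  obtain ⟨B, C, H⟩ := h e he L s hs
  rw [H t ht, H 0 hs.zero_mem, H L hs.length_mem, Pi.zero_apply]
  have := hs.pos.ne'
  field_simp
  ring

/-- In the interior of a segment the slopes in the two directions cancel. -/
theorem slopeSum_of_notMem (hΓ : IsMetrizedGraph Γ) (hW : IsVertexSet W) (h : IsQuadratic W A f)
    (hpW : p ∉ W) : slopeSum f p = 0 := by
  obtain ⟨e, he, L, s, hs, t₀, ht₀, hst, k₀, k₁, hne, huniv, ε, hε, harm⟩ :=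
    exists_opposite_arms hΓ hW hpW
  obtain ⟨B, C, H⟩ := h e he L s hs
  set d := 2 * A e * t₀ + B with hd
  have h0 : HasDerivWithinAt (fun t => f (arm p k₀ t)) d (Ici 0) 0 := by
    have h1 := (hasDerivAt_quadratic (A e) (2 * A e * t₀ + B) (A e * t₀ ^ 2 + B * t₀ + C)
      0).hasDerivWithinAt (s := Ici 0)
    refine (h1.congr_of_eventuallyEq (f₁ := fun t => f (arm p k₀ t)) ?_ ?_).congr_deriv
      (by rw [hd]; ring)
    · filter_upwards [Ico_mem_nhdsGE hε] with t ht
      rw [(harm t ht).2.2.1, H _ (harm t ht).1]; ring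
    · rw [(harm 0 ⟨le_rfl, hε⟩).2.2.1, H _ (harm 0 ⟨le_rfl, hε⟩).1]; ring
  have h1 : HasDerivWithinAt (fun t => f (arm p k₁ t)) (-d) (Ici 0) 0 := by
    have h1 := (hasDerivAt_quadratic (A e) (-(2 * A e * t₀ + B)) (A e * t₀ ^ 2 + B * t₀ + C)
      0).hasDerivWithinAt (s := Ici 0)
    refine (h1.congr_of_eventuallyEq (f₁ := fun t => f (arm p k₁ t)) ?_ ?_).congr_deriv
      (by rw [hd]; ring)
    · filter_upwards [Ico_mem_nhdsGE hε] with t ht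
      rw [(harm t ht).2.2.2, H _ (harm t ht).2.1]; ring
    · rw [(harm 0 ⟨le_rfl, hε⟩).2.2.2, H _ (harm 0 ⟨le_rfl, hε⟩).2.1]; ring
  have hu := uniqueDiffOn_Ici (0 : ℝ) 0 self_mem_Ici
  rw [slopeSum, huniv, Finset.sum_pair hne, dirDeriv, dirDeriv, h0.derivWithin hu,
    h1.derivWithin hu, add_neg_cancel]

theorem slopeSum_of_mem (hΓ : IsMetrizedGraph Γ) (hW : IsVertexSet W) (h : IsQuadratic W A f)
    (hpW : p ∈ W) (m : Γ → ℝ)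
    (hm : ∀ e ∈ segments W, ∀ L s, IsParam e L s → s 0 = p →
      (f (s L) - f p) / L - A e * L = m (s L)) :
    slopeSum f p = ∑ q ∈ neighbours hW p, m q := by
  refine (slopeSum_eq_sum_neighbours hΓ hW hpW m ?_).1
  rintro e he L s hs rfl
  rw [← hm e he L s hs rfl]
  exact h.hasDerivWithinAt_slope he hs

theorem differentiable_arm (hΓ : IsMetrizedGraph Γ) (hW : IsVertexSet W) (h : IsQuadratic W A f)
    (p : Γ) (k : Fin (valence p)) :
    DifferentiableWithinAt ℝ (fun t => f (arm p k t)) (Ici 0) 0 := by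
  obtain ⟨r, hr⟩ := exists_isStarChart_arm hΓ p
  obtain ⟨e, he, L, s, hs, t₀, ht₀, -, -, ε, hε, harm⟩ := exists_arm_param hΓ hW hr k
  obtain ⟨B, C, H⟩ := h e he L s hs
  have h1 := (hasDerivAt_quadratic (A e) (2 * A e * t₀ + B) (A e * t₀ ^ 2 + B * t₀ + C)
      0).hasDerivWithinAt (s := Ici 0)
  refine (h1.congr_of_eventuallyEq (f₁ := fun t => f (arm p k t)) ?_ ?_).differentiableWithinAt
  · filter_upwards [Ico_mem_nhdsGE hε] with t ht
    rw [(harm t ht).2, H _ (harm t ht).1]; ring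
  · rw [(harm 0 ⟨le_rfl, hε⟩).2, H _ (harm 0 ⟨le_rfl, hε⟩).1]; ring

omit [MetricSpace Γ] in
theorem iteratedDeriv_two (H : ∃ B C : ℝ, ∀ t ∈ Icc 0 L, f (s t) = A e * t ^ 2 + B * t + C)
    {t : ℝ} (ht : t ∈ Ioo 0 L) : iteratedDeriv 2 (fun u => f (s u)) t = 2 * A e := by
  obtain ⟨B, C, H⟩ := H
  have : (fun u => f (s u)) =ᶠ[𝓝 t] fun u => A e * u ^ 2 + B * u + C := by
    filter_upwards [Ioo_mem_nhds ht.1 ht.2] with u hu using H u (Ioo_subset_Icc_self hu)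
  rw [this.iteratedDeriv_eq, iteratedDeriv_two_quadratic]

theorem isSmoothWrt (hΓ : IsMetrizedGraph Γ) (hW : IsVertexSet W) (h : IsQuadratic W A f) :
    IsSmoothWrt W f where
  continuous := h.continuous hΓ hW
  dirDeriv := h.differentiable_arm hΓ hW
  contDiff e he L s hs := by
    obtain ⟨B, C, H⟩ := h e he L s hs
    have : ContDiff ℝ 2 fun u : ℝ => A e * u ^ 2 + B * u + C := by fun_prop
    exact this.contDiffOn.congr fun t ht => H t (Ioo_subset_Icc_self ht)
  bounded e he L s hs :=
    ⟨|2 * A e|, fun t ht => by rw [iteratedDeriv_two (h e he L s hs) ht]⟩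

/-- Since `f` is quadratic, the value does not depend on the local parametrization. -/
theorem secondDeriv_eq (hΓ : IsMetrizedGraph Γ) (hW : IsVertexSet W) (h : IsQuadratic W A f)
    (he : e ∈ segments W) {x : Γ} (hx : x ∈ e) (hxW : x ∉ W) : secondDeriv f x = 2 * A e := by
  obtain ⟨L, s, hs⟩ := hW.segment e he
  obtain ⟨t₀, ht₀, rfl⟩ := mem_image_Ioo_of_notMem hΓ hW he hs hx hxW
  have hopen := isOpen_image_Ioo hΓ hW he hs
  have hex : ∃ σ, IsLocalParam (s t₀) σ := by
    refine ⟨fun t => s (t₀ + t), by simp, min t₀ (L - t₀),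
      lt_min ht₀.1 (by linarith [ht₀.2]), ?_, ?_⟩
    · intro a ha b hb
      have h1 := min_le_left t₀ (L - t₀)
      have h2 := min_le_right t₀ (L - t₀)
      rw [hs.dist_eq _ ⟨by linarith [ha.1], by linarith [ha.2]⟩ _
        ⟨by linarith [hb.1], by linarith [hb.2]⟩]
      congr 1; ring
    · filter_upwards [hopen.mem_nhds (mem_image_of_mem s ht₀), Metric.ball_mem_nhds (s t₀)
        (lt_min ht₀.1 (show 0 < L - t₀ by linarith [ht₀.2]))] with z hz hzb
      obtain ⟨u, hu, rfl⟩ := hz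
      rw [Metric.mem_ball, hs.dist_eq _ (Ioo_subset_Icc_self hu) _ (Ioo_subset_Icc_self ht₀),
        abs_lt] at hzb
      exact ⟨u - t₀, hzb, by simp⟩
  rw [secondDeriv, dif_pos hex]
  obtain ⟨hσ0, ε, hε, hiso, hnhds⟩ := hex.choose_spec
  set σ := hex.choose with hσ
  have hcont : ContinuousAt σ 0 := by
    have hl : LipschitzOnWith 1 σ (Ioo (-ε) ε) := by
      refine LipschitzOnWith.of_dist_le_mul fun a ha b hb => ?_
      rw [hiso a ha b hb, NNReal.coe_one, one_mul, Real.dist_eq]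
    exact hl.continuousOn.continuousAt (Ioo_mem_nhds (by linarith) hε)
  have hev : ∀ᶠ t in 𝓝 (0 : ℝ), t ∈ Ioo (-ε) ε ∧ σ t ∈ s '' Ioo 0 L := by
    have h1 : ∀ᶠ t in 𝓝 (0 : ℝ), t ∈ Ioo (-ε) ε := Ioo_mem_nhds (by linarith) hε
    exact h1.and (hcont.eventually (by
      rw [hσ0]; exact hopen.mem_nhds (mem_image_of_mem s ht₀)))
  -- near `0` the chosen parametrization follows the segment in one of the two directions
  set I := {t | t ∈ Ioo (-ε) ε ∧ σ t ∈ s '' Ioo 0 L} with hI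
  have h0I : (0 : ℝ) ∈ I := hev.self_of_nhds
  obtain ⟨B, C, H⟩ := h e he L s hs
  have hmem : ∀ a ∈ I, σ a ∈ e := fun a ha => by
    have := ha.2; rw [hs.image_Ioo] at this; exact this.1
  obtain ⟨t₁, ht₁, K | K⟩ := hs.eq_translate h0I (fun a ha b hb => hiso a ha.1 b hb.1) hmem
  · have : (fun t => f (σ t)) =ᶠ[𝓝 0]
        fun t => A e * t ^ 2 + (2 * A e * t₁ + B) * t + (A e * t₁ ^ 2 + B * t₁ + C) := by
      filter_upwards [hev] with t ht
      rw [(K t ht).2, H _ (K t ht).1]; ring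
    rw [this.iteratedDeriv_eq, iteratedDeriv_two_quadratic]
  · have : (fun t => f (σ t)) =ᶠ[𝓝 0]
        fun t => A e * t ^ 2 + (-(2 * A e * t₁ + B)) * t + (A e * t₁ ^ 2 + B * t₁ + C) := by
      filter_upwards [hev] with t ht
      rw [(K t ht).2, H _ (K t ht).1]; ring
    rw [this.iteratedDeriv_eq, iteratedDeriv_two_quadratic]

end IsQuadratic

end Quadratic

/-! ### The Laplacian of a piecewise quadratic function -/

section Laplacian

theorem withDensityᵥ_sum_mul {α ι : Type*} [MeasurableSpace α] {μ : Measure α} (F : Finset ι)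
    (c : ι → ℝ) (g : ι → α → ℝ) (hg : ∀ i ∈ F, Integrable (g i) μ) :
    μ.withDensityᵥ (fun x => ∑ i ∈ F, c i * g i x) = ∑ i ∈ F, c i • μ.withDensityᵥ (g i) := by
  classical
  induction F using Finset.induction_on with
  | empty => simp only [Finset.sum_empty]; exact withDensityᵥ_zero
  | insert i F hi ih =>
    have hF : ∀ j ∈ F, Integrable (g j) μ := fun j hj => hg j (Finset.mem_insert_of_mem hj)
    have hi' := hg i (Finset.mem_insert_self _ _)
    rw [Finset.sum_insert hi, ← ih hF, ← withDensityᵥ_smul (g i) (c i)]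
    simp only [Finset.sum_insert hi]
    exact withDensityᵥ_add' (hi'.const_mul (c i))
      (integrable_finsetSum _ fun j hj => (hF j hj).const_mul (c j))

variable {Γ : Type*} [MetricSpace Γ] [MeasurableSpace Γ] [BorelSpace Γ] {W : Set Γ} {e : Set Γ}
  {L : ℝ} {s : ℝ → Γ} {A : Set Γ → ℝ} {f : Γ → ℝ}

theorem arcLength_lt_top (hs : IsParam e L s) : arcLength Γ e < ⊤ := by
  have hl : LipschitzOnWith 1 s (Icc 0 L) := by
    refine LipschitzOnWith.of_dist_le_mul fun a ha b hb => ?_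
    rw [hs.dist_eq a ha b hb, NNReal.coe_one, one_mul, Real.dist_eq]
  have := hl.hausdorffMeasure_image_le (d := 1) zero_le_one
  rw [hs.image_eq, hausdorffMeasure_real, Real.volume_Icc] at this
  refine this.trans_lt ?_
  simp

/-- The total length is finite, so that all densities below are integrable. -/
theorem isFiniteMeasure_arcLength (hΓ : IsMetrizedGraph Γ) (hW : IsVertexSet W) :
    IsFiniteMeasure (arcLength Γ) := by
  refine ⟨?_⟩
  have hcov : (univ : Set Γ) ⊆ ⋃ e ∈ segments W, e := fun x _ => by
    obtain ⟨e, he, hx⟩ := exists_segment_of_mem hΓ hW x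
    exact mem_biUnion he hx
  refine (measure_mono hcov).trans_lt (measure_biUnion_lt_top (segments_finite hΓ hW) ?_)
  intro e he
  obtain ⟨L, s, hs⟩ := hW.segment e he
  exact arcLength_lt_top hs

theorem arcLength_finite_null {F : Set Γ} (hF : F.Finite) : arcLength Γ F = 0 := by
  have : NullSingletonClass (Measure.hausdorffMeasure 1 : Measure Γ) :=
    Measure.nullSingletonClass_hausdorff Γ zero_lt_one
  exact hF.measure_zero (Measure.hausdorffMeasure 1)

/-- The Laplacian of a piecewise quadratic function. -/
theorem IsQuadratic.laplacian_eq (hΓ : IsMetrizedGraph Γ) (hW : IsVertexSet W)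
    (h : IsQuadratic W A f) :
    laplacian f = ∑ e ∈ (segments_finite hΓ hW).toFinset, (-2 * A e) • arcLengthOn e -
      ∑ p ∈ hW.finite.toFinset, slopeSum f p • pointMass p := by
  classical
  have := isFiniteMeasure_arcLength hΓ hW
  set F := (segments_finite hΓ hW).toFinset with hF
  -- a point outside the finite set `W` lies in exactly one segment
  have hae : secondDeriv f =ᵐ[arcLength Γ]
      fun x => ∑ e ∈ F, (2 * A e) * e.indicator (fun _ => (1 : ℝ)) x := by
    filter_upwards [compl_mem_ae_iff.2 (arcLength_finite_null hW.finite)] with x hx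
    obtain ⟨e, he, hxe, -⟩ := exists_segment_of_notMem hW hx
    rw [h.secondDeriv_eq hΓ hW he hxe hx, Finset.sum_eq_single e]
    · rw [indicator_of_mem hxe, mul_one]
    · intro e' he' hne
      rw [indicator_of_notMem, mul_zero]
      intro hxe'
      exact hne (segment_eq_of_mem hΓ hW ((Finite.mem_toFinset _).1 he') he hxe' hxe hx)
    · intro hn
      exact absurd ((Finite.mem_toFinset _).2 he) hn
  have hint : ∀ e ∈ F, Integrable (e.indicator (fun _ => (1 : ℝ))) (arcLength Γ) := by
    intro e he
    obtain ⟨L, s, hs⟩ := hW.segment e ((Finite.mem_toFinset _).1 he)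
    exact (integrable_const 1).indicator hs.isClosed.measurableSet
  have hdens : (arcLength Γ).withDensityᵥ (secondDeriv f) =
      ∑ e ∈ F, (2 * A e) • arcLengthOn e := by
    rw [WithDensityᵥEq.congr_ae hae, withDensityᵥ_sum_mul F _ _ hint]
    rfl
  have hpoint : ∑ᶠ p, slopeSum f p • pointMass p =
      ∑ p ∈ hW.finite.toFinset, slopeSum f p • pointMass p := by
    refine finsum_eq_sum_of_support_subset _ fun p hp => ?_
    rw [Finite.coe_toFinset]
    by_contra hpW
    exact hp (by simp only; rw [h.slopeSum_of_notMem hΓ hW hpW, zero_smul])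
  rw [laplacian, hdens, hpoint, ← Finset.sum_neg_distrib]
  refine congrArg (· - _) (Finset.sum_congr rfl fun e _ => ?_)
  rw [neg_mul]
  exact (neg_smul _ _).symm

end Laplacian

/-! ### The maximum principle -/

section MaximumPrinciple

variable {Γ : Type*} [MetricSpace Γ] {W : Set Γ} {f g : Γ → ℝ} {p y z : Γ}

/-- `f` is continuous, and affine on a short initial piece of each arm. Unlike piecewise affinity
with respect to a vertex set, this condition is visibly stable under linear combinations. -/
structure IsLocallyAffine (f : Γ → ℝ) : Prop where
  continuous : Continuous f
  arm : ∀ p k, ∃ c : ℝ, ∃ ε > 0, ∀ t ∈ Ico 0 ε, f (arm p k t) = f p + c * t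

theorem IsQuadratic.isLocallyAffine (hΓ : IsMetrizedGraph Γ) (hW : IsVertexSet W)
    (h : IsQuadratic W 0 f) : IsLocallyAffine f where
  continuous := h.continuous hΓ hW
  arm p k := by
    obtain ⟨r, hr⟩ := exists_isStarChart_arm hΓ p
    obtain ⟨e, he, L, s, hs, t₀, ht₀, hst, -, ε, hε, harm⟩ := exists_arm_param hΓ hW hr k
    obtain ⟨B, C, H⟩ := h e he L s hs
    refine ⟨B, ε, hε, fun t ht => ?_⟩
    have hp : f p = B * t₀ + C := by
      rw [← hst, H _ (Ico_subset_Icc_self ht₀), Pi.zero_apply]; ring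
    rw [(harm t ht).2, H _ (harm t ht).1, hp, Pi.zero_apply]; ring

namespace IsLocallyAffine

theorem add_const_mul (hf : IsLocallyAffine f) (hg : IsLocallyAffine g) (c : ℝ) :
    IsLocallyAffine (fun x => f x + c * g x) where
  continuous := hf.continuous.add (continuous_const.mul hg.continuous)
  arm p k := by
    obtain ⟨a, ε, hε, h⟩ := hf.arm p k
    obtain ⟨b, δ, hδ, h'⟩ := hg.arm p k
    refine ⟨a + c * b, min ε δ, lt_min hε hδ, fun t ht => ?_⟩
    rw [h t ⟨ht.1, ht.2.trans_le (min_le_left _ _)⟩, h' t ⟨ht.1, ht.2.trans_le (min_le_right _ _)⟩]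
    ring

theorem const (c : ℝ) : IsLocallyAffine (fun _ : Γ => c) where
  continuous := continuous_const
  arm _ _ := ⟨0, 1, one_pos, fun t _ => by simp⟩

theorem hasDerivWithinAt {k : Fin (valence p)} {c ε : ℝ} (hε : 0 < ε)
    (h : ∀ t ∈ Ico 0 ε, f (MetrizedGraph.arm p k t) = f p + c * t) :
    HasDerivWithinAt (fun t => f (MetrizedGraph.arm p k t)) c (Ici 0) 0 := by
  have h1 : HasDerivAt (fun t : ℝ => f p + c * t) c 0 := by
    simpa using ((hasDerivAt_id (0 : ℝ)).const_mul c).const_add (f p)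
  refine h1.hasDerivWithinAt.congr_of_eventuallyEq ?_ (h 0 ⟨le_rfl, hε⟩)
  filter_upwards [Ico_mem_nhdsGE hε] with t ht using h t ht

theorem differentiable_arm (hf : IsLocallyAffine f) (p : Γ) (k : Fin (valence p)) :
    DifferentiableWithinAt ℝ (fun t => f (MetrizedGraph.arm p k t)) (Ici 0) 0 := by
  obtain ⟨c, ε, hε, h⟩ := hf.arm p k
  exact (hasDerivWithinAt hε h).differentiableWithinAt

theorem exists_dirDeriv (hf : IsLocallyAffine f) (p : Γ) (k : Fin (valence p)) :
    ∃ ε > 0, ∀ t ∈ Ico 0 ε, f (MetrizedGraph.arm p k t) = f p + dirDeriv f p k * t := by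
  obtain ⟨c, ε, hε, h⟩ := hf.arm p k
  refine ⟨ε, hε, ?_⟩
  rwa [dirDeriv, (hasDerivWithinAt hε h).derivWithin (uniqueDiffOn_Ici 0 0 self_mem_Ici)]

/-- At a maximum the slopes are nonpositive; if their sum vanishes, all of them do, and the
function is constant nearby. -/
theorem eventually_eq_of_isMax (hΓ : IsMetrizedGraph Γ) (hf : IsLocallyAffine f)
    (hmax : ∀ x, f x ≤ f p) (hp : slopeSum f p = 0) : ∀ᶠ x in 𝓝 p, f x = f p := by
  obtain ⟨r, hr⟩ := exists_isStarChart_arm hΓ p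
  choose ε hε harm using hf.exists_dirDeriv p
  have hle : ∀ k ∈ Finset.univ, dirDeriv f p k ≤ 0 := by
    intro k _
    have hε2 : (0 : ℝ) < ε k / 2 := half_pos (hε k)
    have h1 := hmax (MetrizedGraph.arm p k (ε k / 2))
    rw [harm k _ ⟨hε2.le, by linarith⟩] at h1
    by_contra hpos
    have := mul_pos (not_le.1 hpos) hε2
    linarith
  have hzero := (Finset.sum_eq_zero_iff_of_nonpos hle).1 hp
  have hev : ∀ᶠ t in 𝓝[>] (0 : ℝ), (∀ k, t < ε k) ∧ t ∈ Ioo 0 r := by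
    refine (eventually_all.2 fun k => ?_).and (Ioo_mem_nhdsGT hr.r_pos)
    filter_upwards [Ioo_mem_nhdsGT (hε k)] with t ht using ht.2
  obtain ⟨δ, hδε, hδ⟩ := hev.exists
  filter_upwards [(hr.mono hδ.1 hδ.2.le).nhds] with x hx
  obtain ⟨k, t, ht, rfl⟩ := mem_iUnion.1 hx
  rw [harm k t ⟨ht.1, ht.2.trans (hδε k)⟩, hzero k (Finset.mem_univ k), zero_mul, add_zero]

/-- The maximum principle: a function that is harmonic outside `y` has its maximum at `y`. -/
theorem le_of_slopeSum_eq_zero (hΓ : IsMetrizedGraph Γ) (hf : IsLocallyAffine f)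
    (hy : ∀ p ≠ y, slopeSum f p = 0) (x : Γ) : f x ≤ f y := by
  have := hΓ.compact
  have := hΓ.connected
  obtain ⟨x₀, -, hx₀⟩ := isCompact_univ.exists_isMaxOn ⟨y, mem_univ y⟩ hf.continuous.continuousOn
  have hmax : ∀ x, f x ≤ f x₀ := fun x => hx₀ (mem_univ x)
  by_contra hlt
  have hclopen : IsClopen {x | f x = f x₀} := by
    refine ⟨isClosed_eq hf.continuous continuous_const, isOpen_iff_mem_nhds.2 fun p hp => ?_⟩
    have hp' : f p = f x₀ := hp
    have hpy : p ≠ y := by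
      rintro rfl
      exact hlt (hp' ▸ hmax x)
    have := eventually_eq_of_isMax hΓ hf (fun x => hp' ▸ hmax x) (hy p hpy)
    filter_upwards [this] with x hx using hx.trans hp'
  have huniv := hclopen.eq_univ ⟨x₀, rfl⟩
  have : f y = f x₀ := by
    have : y ∈ {x | f x = f x₀} := huniv ▸ mem_univ y
    exact this
  exact hlt (this ▸ hmax x)

/-- A function that is harmonic outside one point is constant. -/
theorem eq_of_slopeSum_eq_zero (hΓ : IsMetrizedGraph Γ) (hf : IsLocallyAffine f)
    (hy : ∀ p ≠ y, slopeSum f p = 0) (x : Γ) : f x = f y := by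
  refine le_antisymm (le_of_slopeSum_eq_zero hΓ hf hy x) ?_
  have h0 := const (Γ := Γ) 0
  have := le_of_slopeSum_eq_zero hΓ (h0.add_const_mul hf (-1)) (y := y) (fun p hp => by
    rw [slopeSum_add_const_mul (h0.differentiable_arm p) (hf.differentiable_arm p), hy p hp,
      slopeSum_const]; simp) x
  linarith

end IsLocallyAffine

end MaximumPrinciple

open Classical in
/-- The function which is `1` at `y` and `0` elsewhere. -/
def delta {α : Type*} (y p : α) : ℝ := if p = y then 1 else 0

theorem delta_self {α : Type*} (y : α) : delta y y = 1 := if_pos rfl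

theorem delta_of_ne {α : Type*} {y p : α} (h : p ≠ y) : delta y p = 0 := if_neg h

/-! ### Existence and uniqueness of potentials -/

section Existence

variable {Γ : Type*} [MetricSpace Γ] {W : Set Γ} {f g : Γ → ℝ} {p q y z : Γ}

/-- A function on the vertices extends to a function that is affine on the segments. -/
theorem exists_isQuadratic_extension (hΓ : IsMetrizedGraph Γ) (hW : IsVertexSet W) (h : Γ → ℝ) :
    ∃ f, IsQuadratic W 0 f ∧ ∀ p ∈ W, f p = h p := by
  classical
  obtain ⟨l, σ, hσ⟩ := hW.exists_params
  set E : Γ → Set Γ := fun x => closure (connectedComponentIn Wᶜ x) with hE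
  refine ⟨fun x => if x ∈ W then h x else h (σ (E x) 0) +
    (h (σ (E x) (l (E x))) - h (σ (E x) 0)) / l (E x) * dist x (σ (E x) 0), ?_,
    fun p hp => if_pos hp⟩
  refine isQuadratic_of_exists_param fun e he => ⟨l e, σ e, hσ e he,
    (h (σ e (l e)) - h (σ e 0)) / l e, h (σ e 0), fun t ht => ?_⟩
  have hs := hσ e he
  obtain ⟨h0, h1⟩ := ends_mem hΓ hW he hs
  have hne := hs.pos.ne'
  simp only [Pi.zero_apply, zero_mul, zero_add]
  rcases ht.1.eq_or_lt with rfl | ht0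
  · rw [if_pos h0]; ring
  rcases ht.2.eq_or_lt with rfl | htL
  · rw [if_pos h1]; field_simp; ring
  have hn := apply_notMem hΓ hW he hs ⟨ht0, htL⟩
  have hEe : E (σ e t) = e := (eq_closure_of_mem hΓ hW he (hs.apply_mem ht) hn).symm
  rw [if_neg hn, hEe, hs.dist_left ht]
  ring

open Classical in
/-- The inverse length of the segment between `p` and `q`, or `0` if there is none. -/
def conductance (W : Set Γ) (p q : Γ) : ℝ := if Adj W p q then (dist p q)⁻¹ else 0

theorem conductance_comm (W : Set Γ) (p q : Γ) : conductance W p q = conductance W q p := by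
  simp only [conductance, dist_comm p q]
  congr 1
  exact propext ⟨Adj.symm, Adj.symm⟩

theorem slopeSum_eq_sum_conductance (hΓ : IsMetrizedGraph Γ) (hW : IsVertexSet W)
    (h : IsQuadratic W 0 f) (hp : p ∈ W) :
    slopeSum f p = ∑ q ∈ hW.finite.toFinset, conductance W p q * (f q - f p) := by
  rw [h.slopeSum_of_mem hΓ hW hp (fun q => (dist p q)⁻¹ * (f q - f p)), neighbours,
    Finset.sum_filter]
  · refine Finset.sum_congr rfl fun q _ => ?_
    rw [conductance]
    split_ifs <;> simp
  · rintro e he L s hs rfl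
    rw [hs.dist_ends, Pi.zero_apply]
    ring

/-- Green's identity: the Laplacian is symmetric. -/
theorem green (hΓ : IsMetrizedGraph Γ) (hW : IsVertexSet W) (hf : IsQuadratic W 0 f)
    (hg : IsQuadratic W 0 g) :
    ∑ p ∈ hW.finite.toFinset, g p * slopeSum f p =
      ∑ p ∈ hW.finite.toFinset, f p * slopeSum g p := by
  have key : ∀ u v : Γ → ℝ, IsQuadratic W 0 u →
      ∑ p ∈ hW.finite.toFinset, v p * slopeSum u p =
        ∑ p ∈ hW.finite.toFinset, ∑ q ∈ hW.finite.toFinset,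
          (conductance W p q * (v p * u q) - conductance W p q * (v p * u p)) := by
    intro u v hu
    refine Finset.sum_congr rfl fun p hp => ?_
    rw [slopeSum_eq_sum_conductance hΓ hW hu ((Finite.mem_toFinset _).1 hp), Finset.mul_sum]
    exact Finset.sum_congr rfl fun q _ => by ring
  rw [key f g hf, key g f hg]
  simp only [Finset.sum_sub_distrib]
  congr 1
  · rw [Finset.sum_comm]
    refine Finset.sum_congr rfl fun p _ => Finset.sum_congr rfl fun q _ => ?_
    rw [conductance_comm]; ring
  · exact Finset.sum_congr rfl fun p _ => Finset.sum_congr rfl fun q _ => by ring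

theorem sum_mul_delta (hW : IsVertexSet W) (hy : y ∈ W) (f : Γ → ℝ) :
    ∑ p ∈ hW.finite.toFinset, f p * delta y p = f y := by
  rw [Finset.sum_eq_single y]
  · rw [delta_self, mul_one]
  · intro p _ hp; rw [delta_of_ne hp, mul_zero]
  · intro h; exact absurd ((Finite.mem_toFinset _).2 hy) h

/-- The Dirichlet problem with ground `y`: by the maximum principle the grounded Laplacian on the
functions on `W` is injective, hence surjective. -/
theorem exists_isQuadratic_slopeSum (hΓ : IsMetrizedGraph Γ) (hW : IsVertexSet W) (hy : y ∈ W)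
    (hz : z ∈ W) :
    ∃ f, IsQuadratic W 0 f ∧ f y = 0 ∧ ∀ p, slopeSum f p = delta y p - delta z p := by
  classical
  set F := hW.finite.toFinset with hF
  have hmem : ∀ {x}, x ∈ F ↔ x ∈ W := Finite.mem_toFinset _
  let y' : F := ⟨y, hmem.2 hy⟩
  let T : (F → ℝ) →ₗ[ℝ] (F → ℝ) :=
    { toFun := fun h p => if p = y' then h y' else ∑ q : F, conductance W p q * (h q - h p)
      map_add' := fun h h' => by
        ext p
        simp only [Pi.add_apply]
        split_ifs
        · rfl
        · rw [← Finset.sum_add_distrib]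
          exact Finset.sum_congr rfl fun q _ => by ring
      map_smul' := fun c h => by
        ext p
        simp only [Pi.smul_apply, smul_eq_mul, RingHom.id_apply]
        split_ifs
        · rfl
        · rw [Finset.mul_sum]
          exact Finset.sum_congr rfl fun q _ => by ring }
  have hext : ∀ h : F → ℝ, ∃ f, IsQuadratic W 0 f ∧ (∀ p : F, f p = h p) ∧
      ∀ p : F, p ≠ y' → slopeSum f p = T h p := by
    intro h
    obtain ⟨f, hf, hfh⟩ := exists_isQuadratic_extension hΓ hW
      (fun x => if hx : x ∈ F then h ⟨x, hx⟩ else 0)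
    have hfh' : ∀ p : F, f p = h p := fun p => by
      rw [hfh p (hmem.1 p.2), dif_pos p.2]
    refine ⟨f, hf, hfh', fun p hp => ?_⟩
    rw [slopeSum_eq_sum_conductance hΓ hW hf (hmem.1 p.2), ← hF, ← Finset.sum_coe_sort]
    simp only [T, LinearMap.coe_mk, AddHom.coe_mk, if_neg hp, hfh']
  have hinj : Function.Injective T := by
    rw [injective_iff_map_eq_zero]
    intro h hh
    obtain ⟨f, hf, hfh, hfT⟩ := hext h
    have hconst := (hf.isLocallyAffine hΓ hW).eq_of_slopeSum_eq_zero hΓ (y := y) (fun p hp => by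
      by_cases hpW : p ∈ W
      · rw [hfT ⟨p, hmem.2 hpW⟩ (fun H => hp (congrArg Subtype.val H)), hh]; rfl
      · exact hf.slopeSum_of_notMem hΓ hW hpW)
    have h0 : h y' = 0 := by
      have := congrFun hh y'
      simpa [T] using this
    ext p
    rw [← hfh p, hconst p, hfh y', h0]; rfl
  obtain ⟨h, hh⟩ := (LinearMap.injective_iff_surjective.1 hinj)
    (fun p => if p = y' then 0 else - delta z p)
  obtain ⟨f, hf, hfh, hfT⟩ := hext h
  have hfy : f y = 0 := by
    have := congrFun hh y'
    simp only [T, LinearMap.coe_mk, AddHom.coe_mk, if_pos] at this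
    rw [← this]; exact hfh y'
  have hslope : ∀ p ≠ y, slopeSum f p = - delta z p := by
    intro p hp
    by_cases hpW : p ∈ W
    · have hne : (⟨p, hmem.2 hpW⟩ : F) ≠ y' := fun H => hp (congrArg Subtype.val H)
      rw [hfT ⟨p, hmem.2 hpW⟩ hne, hh]
      exact if_neg hne
    · rw [hf.slopeSum_of_notMem hΓ hW hpW, delta_of_ne (by rintro rfl; exact hpW hz), neg_zero]
  refine ⟨f, hf, hfy, fun p => ?_⟩
  by_cases hp : p = y
  · subst hp
    -- the slopes of `f` add up to zero, which fixes the slope at the ground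
    have htot := green hΓ hW hf (isQuadratic_const W 1)
    simp only [slopeSum_const, mul_zero, Finset.sum_const_zero, one_mul] at htot
    have hsum : ∑ q ∈ F, (slopeSum f q + 1 * delta z q) = slopeSum f p + 1 * delta z p := by
      refine Finset.sum_eq_single p (fun q _ hq => ?_) (fun h => absurd (hmem.2 hy) h)
      rw [hslope q hq]; ring
    rw [Finset.sum_add_distrib, htot, sum_mul_delta hW hz (fun _ => 1)] at hsum
    rw [delta_self]; linarith
  · rw [hslope p hp, delta_of_ne hp, zero_sub]

end Existence

section Potential

variable {Γ : Type*} [MetricSpace Γ] [MeasurableSpace Γ] [BorelSpace Γ] {W : Set Γ}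
  {f : Γ → ℝ} {p q y z x : Γ}

theorem pointMass_apply_singleton (p q : Γ) : pointMass p {q} = delta p q := by
  rw [pointMass, Measure.toSignedMeasure_apply_measurable (measurableSet_singleton q),
    measureReal_def,
    Measure.dirac_apply' p (measurableSet_singleton q)]
  by_cases h : q = p
  · rw [h, delta_self]; simp
  · rw [delta_of_ne h, indicator_of_notMem (fun H => h H.symm)]; simp

omit [BorelSpace Γ] in
theorem pointMass_eq_sum (hW : IsVertexSet W) (hy : y ∈ W) :
    pointMass y = ∑ p ∈ hW.finite.toFinset, delta y p • pointMass p := by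
  rw [Finset.sum_eq_single y]
  · rw [delta_self]; exact (one_smul _ _).symm
  · intro p _ hp; rw [delta_of_ne hp]; exact zero_smul _ _
  · intro h; exact absurd ((Finite.mem_toFinset _).2 hy) h

/-- The Laplacian of a piecewise affine function is discrete. -/
theorem IsQuadratic.laplacian_eq_neg_sum (hΓ : IsMetrizedGraph Γ) (hW : IsVertexSet W)
    (h : IsQuadratic W 0 f) :
    laplacian f = -∑ p ∈ hW.finite.toFinset, slopeSum f p • pointMass p := by
  rw [h.laplacian_eq hΓ hW, Finset.sum_eq_zero, zero_sub]
  intro e _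
  rw [Pi.zero_apply, mul_zero]
  exact zero_smul _ _

/-- The slope sums of a piecewise affine function can be recovered from its Laplacian. -/
theorem IsQuadratic.laplacian_apply_singleton (hΓ : IsMetrizedGraph Γ) (hW : IsVertexSet W)
    (h : IsQuadratic W 0 f) (q : Γ) : laplacian f {q} = - slopeSum f q := by
  have hsum : ∀ (F : Finset Γ) (m : Γ → SignedMeasure Γ),
      (∑ p ∈ F, m p) {q} = ∑ p ∈ F, m p {q} := fun F m => by
    rw [FunLike.coe_sum, Finset.sum_apply]
  rw [h.laplacian_eq_neg_sum hΓ hW, neg_apply, hsum]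
  simp only [smul_apply, pointMass_apply_singleton, smul_eq_mul]
  by_cases hq : q ∈ W
  · rw [Finset.sum_eq_single q]
    · rw [delta_self, mul_one]
    · intro p _ hp; rw [delta_of_ne (Ne.symm hp), mul_zero]
    · intro h; exact absurd ((Finite.mem_toFinset _).2 hq) h
  · rw [h.slopeSum_of_notMem hΓ hW hq, Finset.sum_eq_zero, neg_zero]
    intro p hp
    rw [delta_of_ne (by rintro rfl; exact hq ((Finite.mem_toFinset _).1 hp)), mul_zero]

theorem isPotential_of_slopeSum (hΓ : IsMetrizedGraph Γ) (hW : IsVertexSet W) (hy : y ∈ W)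
    (hz : z ∈ W) (h : IsQuadratic W 0 f) (h0 : f y = 0)
    (hs : ∀ p, slopeSum f p = delta y p - delta z p) : IsPotential y z f where
  affine := by
    refine ⟨W, hW, h.isSmoothWrt hΓ hW, fun e he L s hps => ?_⟩
    obtain ⟨B, C, H⟩ := h e he L s hps
    exact ⟨B, C, fun t ht => by rw [H t ht, Pi.zero_apply]; ring⟩
  laplacian_eq := by
    rw [h.laplacian_eq_neg_sum hΓ hW]
    simp only [hs]
    rw [pointMass_eq_sum hW hy, pointMass_eq_sum hW hz, ← Finset.sum_sub_distrib,
      ← Finset.sum_neg_distrib]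
    refine Finset.sum_congr rfl fun p _ => ?_
    have : ∀ a b : ℝ, ∀ m : SignedMeasure Γ, -((a - b) • m) = b • m - a • m := by
      intro a b m; module
    exact this _ _ _
  grounded := h0

theorem IsPotential.isLocallyAffine_and_slopeSum (hΓ : IsMetrizedGraph Γ) (h : IsPotential y z f) :
    IsLocallyAffine f ∧ ∀ p, slopeSum f p = delta y p - delta z p := by
  obtain ⟨W, hW, -, haff⟩ := h.affine
  have hq : IsQuadratic W 0 f := by
    intro e he L s hs
    obtain ⟨B, C, H⟩ := haff e he L s hs
    exact ⟨B, C, fun t ht => by rw [H t ht, Pi.zero_apply]; ring⟩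
  refine ⟨hq.isLocallyAffine hΓ hW, fun p => ?_⟩
  have := hq.laplacian_apply_singleton hΓ hW p
  rw [h.laplacian_eq, sub_apply, pointMass_apply_singleton,
    pointMass_apply_singleton] at this
  linarith

/-- A function with the slopes of a potential is the potential. -/
theorem eq_jFun (hΓ : IsMetrizedGraph Γ) (hW : IsVertexSet W) (hy : y ∈ W) (hz : z ∈ W)
    (h : IsQuadratic W 0 f) (h0 : f y = 0)
    (hs : ∀ p, slopeSum f p = delta y p - delta z p) : jFun y z = f := by
  have hpot := isPotential_of_slopeSum hΓ hW hy hz h h0 hs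
  have hj : IsPotential y z (jFun y z) := by
    have hex : ∃ j, IsPotential y z j := ⟨f, hpot⟩
    rw [jFun, dif_pos hex]
    exact hex.choose_spec
  obtain ⟨ha, hs'⟩ := hj.isLocallyAffine_and_slopeSum hΓ
  have hla := h.isLocallyAffine hΓ hW
  have := (ha.add_const_mul hla (-1)).eq_of_slopeSum_eq_zero hΓ (y := y) (fun p _ => by
    rw [slopeSum_add_const_mul (ha.differentiable_arm p) (hla.differentiable_arm p), hs, hs']; ring)
  ext x
  have := this x
  rw [hj.grounded, h0] at this
  linarith

theorem jFun_spec (hΓ : IsMetrizedGraph Γ) (hW : IsVertexSet W) (hy : y ∈ W) (hz : z ∈ W) :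
    IsQuadratic W 0 (jFun y z) ∧ jFun y z y = 0 ∧
      ∀ p, slopeSum (jFun y z) p = delta y p - delta z p := by
  obtain ⟨f, hf, h0, hs⟩ := exists_isQuadratic_slopeSum hΓ hW hy hz
  rw [eq_jFun hΓ hW hy hz hf h0 hs]
  exact ⟨hf, h0, hs⟩

/-- Symmetry of the potential kernel. -/
theorem jFun_symm (hΓ : IsMetrizedGraph Γ) (hW : IsVertexSet W) (hy : y ∈ W) (hz : z ∈ W)
    (hx : x ∈ W) : jFun y z x = jFun y x z := by
  obtain ⟨h1, h2, h3⟩ := jFun_spec hΓ hW hy hz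
  obtain ⟨h1', h2', h3'⟩ := jFun_spec hΓ hW hy hx
  have := green hΓ hW h1 h1'
  simp only [h3, h3', mul_sub, Finset.sum_sub_distrib, sum_mul_delta hW hy, sum_mul_delta hW hz,
    sum_mul_delta hW hx, h2, h2'] at this
  linarith

end Potential

/-! ### The effective resistance as a function on the graph -/

section Resistance

variable {Γ : Type*} [MetricSpace Γ] [MeasurableSpace Γ] [BorelSpace Γ] {W : Set Γ}
  {f : Γ → ℝ} {p q y z x : Γ} {e : Set Γ}

/-- The resistance between `x` and `z` in terms of the potentials grounded at `y`. -/
theorem effResistance_eq (hΓ : IsMetrizedGraph Γ) (hW : IsVertexSet W) (hy : y ∈ W) (hz : z ∈ W)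
    (hx : x ∈ W) : effResistance x z = jFun y x x - 2 * jFun y x z + jFun y z z := by
  obtain ⟨h1, -, h3⟩ := jFun_spec hΓ hW hy hx
  obtain ⟨h1', -, h3'⟩ := jFun_spec hΓ hW hy hz
  have hd := h1.add_const_mul h1' (-1)
  have hq : IsQuadratic W 0 (fun u => (jFun y x u + -1 * jFun y z u) +
      -1 * (jFun y x z + -1 * jFun y z z)) := by
    simpa using hd.add_const_mul (isQuadratic_const W (jFun y x z + -1 * jFun y z z)) (-1)
  have hfin : jFun z x = _ := eq_jFun hΓ hW hz hx hq (by ring) fun p => by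
    rw [slopeSum_add_const_mul (hd.differentiable_arm hΓ hW p)
        ((isQuadratic_const W _).differentiable_arm hΓ hW p), slopeSum_const,
      slopeSum_add_const_mul (h1.differentiable_arm hΓ hW p) (h1'.differentiable_arm hΓ hW p),
      h3, h3']
    ring
  rw [effResistance, hfin]
  simp only
  rw [jFun_symm hΓ hW hy hz hx]
  ring

/-- The resistance to a vertex, along a segment: the equation for the slopes at `s t` of the
potential with pole `s t` is solved for its value there. -/
theorem effResistance_apply (hΓ : IsMetrizedGraph Γ) (hW : IsVertexSet W) (hy : y ∈ W) {L : ℝ}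
    {s : ℝ → Γ} (he : e ∈ segments W) (hs : IsParam e L s) {t : ℝ} (ht : t ∈ Icc 0 L) :
    effResistance (s t) y = (effResistance (s 0) (s L) / L ^ 2 - 1 / L) * t ^ 2 +
      (2 * (jFun y (s 0) (s L) - jFun y (s 0) (s 0)) / L + 1) * t + effResistance (s 0) y := by
  classical
  obtain ⟨h0, hL⟩ := ends_mem hΓ hW he hs
  have hpos := hs.pos
  have hne := hpos.ne'
  rw [effResistance_eq hΓ hW hy hL h0]
  have hval : jFun y (s t) (s t) = t * (L - t) / L +
      ((L - t) * (((L - t) * jFun y (s 0) (s 0) + t * jFun y (s 0) (s L)) / L) +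
        t * (((L - t) * jFun y (s 0) (s L) + t * jFun y (s L) (s L)) / L)) / L := by
    rcases ht.1.eq_or_lt with rfl | ht0
    · field_simp; ring
    rcases ht.2.eq_or_lt with rfl | htL
    · field_simp; ring
    have ht' : t ∈ Ioo 0 L := ⟨ht0, htL⟩
    have hn := apply_notMem hΓ hW he hs ht'
    have hW' := hW.insert hΓ (s t)
    have hmem : s t ∈ insert (s t) W := mem_insert _ _
    have hsub : ∀ {u}, u ∈ W → u ∈ insert (s t) W := fun hu => mem_insert_of_mem _ hu
    obtain ⟨hq, -, hsl⟩ := jFun_spec hΓ hW' (hsub hy) hmem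
    have hslope := hq.slopeSum_of_mem hΓ hW' hmem
      (fun q => (jFun y (s t) q - jFun y (s t) (s t)) / dist (s t) q) (by
        rintro E - l σ hσ h0
        rw [← h0, hσ.dist_ends, Pi.zero_apply]; ring)
    have hd1 : dist (s t) (s L) = L - t := by
      rw [hs.dist_eq _ ht _ hs.length_mem, abs_sub_comm, abs_of_nonneg (by linarith)]
    have hty : s t ≠ y := by
      intro H
      exact hn (H ▸ hy)
    rw [neighbours_insert hΓ hW he hs ht', Finset.sum_pair hs.ends_ne, hs.dist_left ht, hd1, hsl,
      delta_of_ne hty, delta_self, jFun_symm hΓ hW' (hsub hy) hmem (hsub h0),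
      jFun_symm hΓ hW' (hsub hy) hmem (hsub hL),
      (jFun_spec hΓ hW hy h0).1.apply_eq_interpolation he hs ht,
      (jFun_spec hΓ hW hy hL).1.apply_eq_interpolation he hs ht,
      jFun_symm hΓ hW hy hL h0] at hslope
    have hLt : L - t ≠ 0 := (sub_pos.2 htL).ne'
    have htne := ht0.ne'
    generalize jFun y (s t) (s t) = R at hslope ⊢
    generalize jFun y (s 0) (s 0) = G₀ at hslope ⊢
    generalize jFun y (s 0) (s L) = G₁ at hslope ⊢
    generalize jFun y (s L) (s L) = G₂ at hslope ⊢
    field_simp at hslope ⊢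
    linear_combination hslope
  rw [effResistance, effResistance, hval]
  field_simp
  ring

variable {L : Set Γ → ℝ} {s : Set Γ → ℝ → Γ}

theorem isQuadratic_effResistance (hΓ : IsMetrizedGraph Γ) (hW : IsVertexSet W) (hy : y ∈ W)
    (hs : ∀ e ∈ segments W, IsParam e (L e) (s e)) :
    IsQuadratic W (fun e => effResistance (s e 0) (s e (L e)) / L e ^ 2 - 1 / L e)
      (fun x => effResistance x y) :=
  isQuadratic_of_exists_param fun e he => ⟨L e, s e, hs e he, _, _,
    fun _ ht => effResistance_apply hΓ hW hy he (hs e he) ht⟩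

/-- Twice the slope sum at `p` of the potential with pole `p`, plus one for each direction. -/
theorem slopeSum_effResistance (hΓ : IsMetrizedGraph Γ) (hW : IsVertexSet W) (hy : y ∈ W)
    (hp : p ∈ W) :
    slopeSum (fun x => effResistance x y) p = 2 * (delta y p - 1) + valence p := by
  obtain ⟨hq, -, hsl⟩ := jFun_spec hΓ hW hy hp
  have h1 := hq.slopeSum_of_mem hΓ hW hp
    (fun q => (jFun y p q - jFun y p p) / dist p q) (by
      rintro E - l σ hσ rfl
      rw [hσ.dist_ends, Pi.zero_apply]; ring)
  obtain ⟨h2, h3⟩ := slopeSum_eq_sum_neighbours hΓ hW hp (f := fun x => effResistance x y)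
    (fun q => 2 * ((jFun y p q - jFun y p p) / dist p q) + 1) (by
      rintro e he l σ hσ rfl
      have := IsQuadratic.hasDerivWithinAt_zero (f := fun x => effResistance x y)
        (A := fun _ => effResistance (σ 0) (σ l) / l ^ 2 - 1 / l) hσ
        (fun t ht => effResistance_apply hΓ hW hy he hσ ht)
      rw [hσ.dist_ends]
      exact this.congr_deriv (by ring))
  rw [h2, Finset.sum_add_distrib, ← Finset.mul_sum, ← h1, hsl, delta_self, h3]
  simp

/-- The canonical measure, with densities expressed by resistances in the whole graph. -/
theorem canonicalMeasure_eq (hΓ : IsMetrizedGraph Γ) (hW : IsVertexSet W) (hy : y ∈ W)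
    (hs : ∀ e ∈ segments W, IsParam e (L e) (s e)) :
    canonicalMeasure y =
      ∑ p ∈ hW.finite.toFinset, (1 - (valence p : ℝ) / 2) • pointMass p +
      ∑ e ∈ (segments_finite hΓ hW).toFinset,
        (1 / L e - effResistance (s e 0) (s e (L e)) / L e ^ 2) • arcLengthOn e := by
  rw [canonicalMeasure, (isQuadratic_effResistance hΓ hW hy hs).laplacian_eq hΓ hW,
    pointMass_eq_sum hW hy,
    smul_sub, Finset.smul_sum, Finset.smul_sum, sub_add, ← Finset.sum_sub_distrib, sub_eq_add_neg,
    ← Finset.sum_neg_distrib, add_comm]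
  congr 1
  · refine Finset.sum_congr rfl fun p hp => ?_
    rw [slopeSum_effResistance hΓ hW hy ((Finite.mem_toFinset _).1 hp)]
    module
  · refine Finset.sum_congr rfl fun e _ => ?_
    module

/-- The canonical measure does not depend on the base point: the formula for a vertex set that
contains both base points involves neither. -/
theorem canonicalMeasure_eq_of_mem (hΓ : IsMetrizedGraph Γ) (hW : IsVertexSet W) (hz : z ∈ W)
    (y : Γ) : canonicalMeasure y = canonicalMeasure z := by
  have hW' := hW.insert hΓ y
  obtain ⟨l, σ, hσ⟩ := hW'.exists_params
  rw [canonicalMeasure_eq hΓ hW' (mem_insert y W) hσ,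
    canonicalMeasure_eq hΓ hW' (mem_insert_of_mem y hz) hσ]

theorem isPiecewiseSmooth_effResistance (hΓ : IsMetrizedGraph Γ) (hW : IsVertexSet W) (y : Γ) :
    IsPiecewiseSmooth (fun x => effResistance x y) := by
  have hW' := hW.insert hΓ y
  obtain ⟨l, σ, hσ⟩ := hW'.exists_params
  exact ⟨_, hW', (isQuadratic_effResistance hΓ hW' (mem_insert y W) hσ).isSmoothWrt hΓ hW'⟩

end Resistance

/-! ### Deleting the interior of a segment -/

section Deletion

variable {Γ : Type*} [MetricSpace Γ] {V : Set Γ} {e E : Set Γ} {L l : ℝ} {s σ : ℝ → Γ}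

theorem IsParam.exists_lift {A : Set Γ} (hs : IsParam e L s) (heA : e ⊆ A) :
    ∃ σ : ℝ → A, IsParam (Subtype.val ⁻¹' e) L σ ∧ ∀ t ∈ Icc 0 L, (σ t : Γ) = s t := by
  classical
  have hmem : ∀ t ∈ Icc 0 L, s t ∈ A := fun t ht => heA (hs.apply_mem ht)
  let σ : ℝ → A := fun t => if h : s t ∈ A then ⟨s t, h⟩ else ⟨s 0, hmem 0 hs.zero_mem⟩
  have hσ : ∀ t ∈ Icc 0 L, (σ t : Γ) = s t := fun t ht => by
    simp only [σ, dif_pos (hmem t ht)]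
  refine ⟨σ, ⟨hs.pos, fun a ha b hb => ?_, ?_⟩, hσ⟩
  · rw [Subtype.dist_eq, hσ a ha, hσ b hb, hs.dist_eq a ha b hb]
  · ext x
    constructor
    · rintro ⟨t, ht, rfl⟩
      rw [mem_preimage, hσ t ht]
      exact hs.apply_mem ht
    · intro hx
      have hx' : (x : Γ) ∈ e := hx
      refine ⟨_, hs.dist_mem hx', Subtype.ext ?_⟩
      rw [hσ _ (hs.dist_mem hx'), hs.apply_dist hx']

theorem isEndpoint_preimage {A : Set Γ} (hs : IsParam e L s) (heA : e ⊆ A) {p : A}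
    (hp : IsEndpoint e (p : Γ)) : IsEndpoint (Subtype.val ⁻¹' e : Set A) p := by
  obtain ⟨σ, hσ, hst⟩ := hs.exists_lift heA
  refine hσ.isEndpoint_iff.2 ((hs.isEndpoint_iff.1 hp).imp (fun h => ?_) fun h => ?_)
  · exact Subtype.ext (h.trans (hst 0 hs.zero_mem).symm)
  · exact Subtype.ext (h.trans (hst L hs.length_mem).symm)

theorem subset_deletion (hΓ : IsMetrizedGraph Γ) (hV : IsVertexSet V) (he : e ∈ segments V)
    (hs : IsParam e L s) (hE : E ∈ segments V) (hne : E ≠ e) : E ⊆ (s '' Ioo 0 L)ᶜ := by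
  intro x hx hxs
  refine hne (segment_eq_of_mem hΓ hV hE he hx ?_ (image_Ioo_subset_compl hΓ hV he hs hxs))
  rw [hs.image_Ioo] at hxs
  exact hxs.1

theorem vertex_mem_deletion (hΓ : IsMetrizedGraph Γ) (hV : IsVertexSet V) (he : e ∈ segments V)
    (hs : IsParam e L s) {p : Γ} (hp : p ∈ V) : p ∈ (s '' Ioo 0 L)ᶜ :=
  fun h => image_Ioo_subset_compl hΓ hV he hs h hp

/-- An arm that avoids `V` either stays outside the open segment or lies in it. -/
theorem arm_notMem_deletion (hΓ : IsMetrizedGraph Γ) (hV : IsVertexSet V) (he : e ∈ segments V)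
    (hs : IsParam e L s) {p : Γ} {n : ℕ} {r : ℝ} {φ : Fin n → ℝ → Γ} (h : IsStarChart p n r φ)
    {k : Fin n} (hav : ∀ t ∈ Ioo 0 r, φ k t ∉ V) {t₀ t : ℝ} (ht₀ : t₀ ∈ Ioo 0 r)
    (hmem : φ k t₀ ∈ s '' Ioo 0 L) (ht : t ∈ Ioo 0 r) : φ k t ∈ s '' Ioo 0 L := by
  obtain ⟨E, hE, hcl, hE'⟩ := exists_segment_of_arm h k hav
  have hee : e = E := by
    rw [← hcl t₀ ht₀]
    refine eq_closure_of_mem hΓ hV he ?_ (hav t₀ ht₀)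
    rw [hs.image_Ioo] at hmem
    exact hmem.1
  exact mem_image_Ioo_of_notMem hΓ hV he hs (hee ▸ hE' t (Ioo_subset_Ico_self ht)) (hav t ht)

/-- The star of a point of `Γ ∖ e°` consists of the arms that do not run into the open segment. -/
theorem isMetrizedGraph_deletion (hΓ : IsMetrizedGraph Γ) (hV : IsVertexSet V)
    (he : e ∈ segments V) (hs : IsParam e L s) (hconn : IsConnected (s '' Ioo 0 L)ᶜ) :
    IsMetrizedGraph ↥(s '' Ioo 0 L)ᶜ := by
  classical
  have := hΓ.compact
  have hc : ConnectedSpace ↥(s '' Ioo 0 L)ᶜ := isConnected_iff_connectedSpace.1 hconn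
  set A := (s '' Ioo 0 L)ᶜ with hA
  refine ⟨isCompact_iff_compactSpace.1 (isOpen_image_Ioo hΓ hV he hs).isClosed_compl.isCompact,
    hc, fun p => ?_⟩
  obtain ⟨n, r, φ, hφ⟩ := hΓ.star (p : Γ)
  obtain ⟨ε, hε, -, h, hav⟩ := exists_arm_notMem hV hφ
  set K : Finset (Fin n) := Finset.univ.filter fun k => ∀ t ∈ Ioo 0 ε, φ k t ∈ A with hK
  have hnotK : ∀ k, k ∉ K → ∀ t ∈ Ioo 0 ε, φ k t ∉ A := by
    intro k hk t ht
    rw [hK, Finset.mem_filter, not_and] at hk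
    have := hk (Finset.mem_univ k)
    push Not at this
    obtain ⟨t₀, ht₀, hmem⟩ := this
    exact not_not.2 (arm_notMem_deletion hΓ hV he hs h (hav k) ht₀ (not_not.1 hmem) ht)
  have hinK : ∀ k ∈ K, ∀ t ∈ Ico 0 ε, φ k t ∈ A := by
    intro k hk t ht
    rcases ht.1.eq_or_lt with rfl | h0
    · rw [h.center]; exact p.2
    · exact (Finset.mem_filter.1 hk).2 t ⟨h0, ht.2⟩
  have hnhds : Subtype.val ⁻¹' (⋃ k, φ k '' Ico 0 ε) ∈ 𝓝 p :=
    continuous_subtype_val.continuousAt.preimage_mem_nhds h.nhds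
  have hKne : K.Nonempty := by
    -- otherwise `p` would be isolated, but the two ends of the segment remain
    by_contra hemp
    rw [Finset.not_nonempty_iff_eq_empty] at hemp
    have hsing : ({p} : Set A) ∈ 𝓝 p := by
      filter_upwards [hnhds] with x hx
      obtain ⟨k, t, ht, hkt⟩ := mem_iUnion.1 hx
      rcases ht.1.eq_or_lt with rfl | h0
      · rw [h.center] at hkt
        exact Subtype.ext hkt.symm
      · exact absurd (hkt ▸ x.2) (hnotK k (by simp [hemp]) t ⟨h0, ht.2⟩)
    have hop : IsOpen ({p} : Set A) := isOpen_iff_mem_nhds.2 fun q hq => by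
      rw [mem_singleton_iff.1 hq]; exact hsing
    have huniv := IsClopen.eq_univ ⟨isClosed_singleton, hop⟩ (singleton_nonempty p)
    obtain ⟨h0, h1⟩ := ends_mem hΓ hV he hs
    have h0' : (⟨s 0, vertex_mem_deletion hΓ hV he hs h0⟩ : A) ∈ ({p} : Set A) :=
      huniv ▸ mem_univ _
    have h1' : (⟨s L, vertex_mem_deletion hΓ hV he hs h1⟩ : A) ∈ ({p} : Set A) :=
      huniv ▸ mem_univ _
    exact hs.ends_ne (congrArg Subtype.val ((mem_singleton_iff.1 h0').trans
      (mem_singleton_iff.1 h1').symm))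
  let ι : Fin K.card → Fin n := fun i => K.equivFin.symm i
  have hιK : ∀ i, ι i ∈ K := fun i => (K.equivFin.symm i).2
  have hιinj : Function.Injective ι :=
    Subtype.val_injective.comp K.equivFin.symm.injective
  have hιsurj : ∀ k ∈ K, ∃ i, ι i = k := fun k hk => ⟨K.equivFin ⟨k, hk⟩, by simp [ι]⟩
  let ψ : Fin K.card → ℝ → A := fun i t => if h : φ (ι i) t ∈ A then ⟨φ (ι i) t, h⟩ else p
  have hψ : ∀ i, ∀ t ∈ Ico 0 ε, (ψ i t : Γ) = φ (ι i) t := fun i t ht => by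
    simp only [ψ, dif_pos (hinK _ (hιK i) t ht)]
  refine ⟨K.card, ε, ψ, hKne.card_pos, hε, fun i => ?_, fun i a ha b hb => ?_,
    fun i j hij a ha b hb => ?_, ?_⟩
  · exact Subtype.ext ((hψ i 0 ⟨le_rfl, hε⟩).trans (h.center _))
  · rw [Subtype.dist_eq, hψ i a ha, hψ i b hb, h.dist_same _ a ha b hb]
  · rw [Subtype.dist_eq, hψ i a ha, hψ j b hb, h.dist_ne _ _ (hιinj.ne hij) a ha b hb]
  · filter_upwards [hnhds] with x hx
    obtain ⟨k, t, ht, hkt⟩ := mem_iUnion.1 hx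
    rcases ht.1.eq_or_lt with rfl | h0
    · refine mem_iUnion.2 ⟨⟨0, hKne.card_pos⟩, 0, ht, Subtype.ext ?_⟩
      rw [hψ _ 0 ht, h.center, ← hkt, h.center]
    · have hk : k ∈ K := by
        by_contra hk
        exact hnotK k hk t ⟨h0, ht.2⟩ (hkt ▸ x.2)
      obtain ⟨i, rfl⟩ := hιsurj k hk
      exact mem_iUnion.2 ⟨i, t, ht, Subtype.ext ((hψ i t ht).trans hkt)⟩

theorem valence_deletion (hΓ : IsMetrizedGraph Γ) (hV : IsVertexSet V) (he : e ∈ segments V)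
    (hs : IsParam e L s) (hΓ' : IsMetrizedGraph ↥(s '' Ioo 0 L)ᶜ) {p : ↥(s '' Ioo 0 L)ᶜ}
    (hp : (p : Γ) ∉ V) : valence p = valence (p : Γ) := by
  have hpe : (p : Γ) ∉ e := fun h => p.2 (mem_image_Ioo_of_notMem hΓ hV he hs h hp)
  obtain ⟨δ, hδ, hball⟩ := Metric.isOpen_iff.1 hs.isClosed.isOpen_compl _ hpe
  obtain ⟨ε₁, hε₁, h₁⟩ := exists_ncard_sphere_eq_valence hΓ (p : Γ)
  obtain ⟨ε₂, hε₂, h₂⟩ := exists_ncard_sphere_eq_valence hΓ' p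
  have hm : 0 < min (min ε₁ ε₂) δ := lt_min (lt_min hε₁ hε₂) hδ
  obtain ⟨t, ht0, ht⟩ := exists_between hm
  rw [lt_min_iff, lt_min_iff] at ht
  rw [← h₁ t ⟨ht0, ht.1.1⟩, ← h₂ t ⟨ht0, ht.1.2⟩,
    ← ncard_image_of_injective _ Subtype.val_injective]
  congr 1
  ext x
  constructor
  · rintro ⟨z, hz, rfl⟩
    exact hz
  · intro hx
    have hxA : x ∈ (s '' Ioo 0 L)ᶜ := by
      intro hxs
      rw [hs.image_Ioo] at hxs
      refine hball ?_ hxs.1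
      rw [Metric.mem_ball, Metric.mem_sphere.1 hx]
      exact ht.2
    exact ⟨⟨x, hxA⟩, hx, rfl⟩

/-- The segments of `Γ ∖ e°` are the segments of `Γ` other than `e`. -/
theorem mem_segments_deletion_iff (hΓ : IsMetrizedGraph Γ) (hV : IsVertexSet V)
    (he : e ∈ segments V) (hs : IsParam e L s) {E' : Set ↥(s '' Ioo 0 L)ᶜ} :
    E' ∈ segments (Subtype.val ⁻¹' V) ↔ ∃ E ∈ segments V, E ≠ e ∧ E' = Subtype.val ⁻¹' E := by
  have key : ∀ E ∈ segments V, E ≠ e →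
      (Subtype.val ⁻¹' E : Set ↥(s '' Ioo 0 L)ᶜ) ∈ segments (Subtype.val ⁻¹' V) ∧
      ∀ z : ↥(s '' Ioo 0 L)ᶜ, (z : Γ) ∈ E → (z : Γ) ∉ V →
        closure (connectedComponentIn (Subtype.val ⁻¹' V)ᶜ z) = Subtype.val ⁻¹' E := by
    intro E hE hne
    obtain ⟨l, τ, hτ⟩ := hV.segment E hE
    obtain ⟨σ, hσ, hστ⟩ := hτ.exists_lift (subset_deletion hΓ hV he hs hE hne)
    obtain ⟨h0, h1⟩ := ends_mem hΓ hV hE hτ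
    have himg : σ '' Ioo 0 l = Subtype.val ⁻¹' (τ '' Ioo 0 l) := by
      ext z
      constructor
      · rintro ⟨t, ht, rfl⟩
        exact ⟨t, ht, (hστ t (Ioo_subset_Icc_self ht)).symm⟩
      · rintro ⟨t, ht, htz⟩
        exact ⟨t, ht, Subtype.ext ((hστ t (Ioo_subset_Icc_self ht)).trans htz)⟩
    obtain ⟨h2, h3⟩ := mem_segments_of_param (W := Subtype.val ⁻¹' V) hσ
      (himg ▸ (isOpen_image_Ioo hΓ hV hE hτ).preimage continuous_subtype_val)
      (by rw [himg]; exact preimage_mono (image_Ioo_subset_compl hΓ hV hE hτ))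
      (by rw [mem_preimage, hστ 0 hτ.zero_mem]; exact h0)
      (by rw [mem_preimage, hστ l hτ.length_mem]; exact h1)
    refine ⟨h2, fun z hz hzV => h3 z ?_⟩
    rw [himg]
    exact mem_image_Ioo_of_notMem hΓ hV hE hτ hz hzV
  constructor
  · rintro ⟨z, hz, rfl⟩
    obtain ⟨E, hE, hzE, -⟩ := exists_segment_of_notMem hV hz
    have hne : E ≠ e := by
      rintro rfl
      exact z.2 (mem_image_Ioo_of_notMem hΓ hV he hs hzE hz)
    exact ⟨E, hE, hne, (key E hE hne).2 z hzE hz⟩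
  · rintro ⟨E, hE, hne, rfl⟩
    exact (key E hE hne).1

/-- Only the ends of `e`, which are vertices, can change their valence. -/
theorem isVertexSet_deletion (hΓ : IsMetrizedGraph Γ) (hV : IsVertexSet V)
    (he : e ∈ segments V) (hs : IsParam e L s) (hΓ' : IsMetrizedGraph ↥(s '' Ioo 0 L)ᶜ) :
    IsVertexSet (Subtype.val ⁻¹' V : Set ↥(s '' Ioo 0 L)ᶜ) where
  finite := hV.finite.preimage Subtype.val_injective.injOn
  nonempty := ⟨⟨s 0, vertex_mem_deletion hΓ hV he hs (ends_mem hΓ hV he hs).1⟩,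
    (ends_mem hΓ hV he hs).1⟩
  valence_ne_two p hp := by
    by_contra hpV
    rw [valence_deletion hΓ hV he hs hΓ' hpV] at hp
    exact hpV (hV.valence_ne_two _ hp)
  segment E' hE' := by
    obtain ⟨E, hE, hne, rfl⟩ := (mem_segments_deletion_iff hΓ hV he hs).1 hE'
    obtain ⟨l, τ, hτ⟩ := hV.segment E hE
    obtain ⟨σ, hσ, -⟩ := hτ.exists_lift (subset_deletion hΓ hV he hs hE hne)
    exact ⟨l, σ, hσ⟩
  inter E₁' h₁ E₂' h₂ hne' := by
    obtain ⟨E₁, hE₁, hne₁, rfl⟩ := (mem_segments_deletion_iff hΓ hV he hs).1 h₁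
    obtain ⟨E₂, hE₂, hne₂, rfl⟩ := (mem_segments_deletion_iff hΓ hV he hs).1 h₂
    obtain ⟨l₁, τ₁, hτ₁⟩ := hV.segment E₁ hE₁
    obtain ⟨l₂, τ₂, hτ₂⟩ := hV.segment E₂ hE₂
    have hsub₁ := subset_deletion hΓ hV he hs hE₁ hne₁
    have hsub₂ := subset_deletion hΓ hV he hs hE₂ hne₂
    rw [← preimage_inter]
    rcases hV.inter E₁ hE₁ E₂ hE₂ (fun H => hne' (by rw [H])) with h | ⟨p, h, hp₁, hp₂⟩
    · left; rw [h, preimage_empty]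
    · right
      have hp : p ∈ E₁ ∩ E₂ := by rw [h]; rfl
      refine ⟨⟨p, hsub₁ hp.1⟩, ?_, isEndpoint_preimage hτ₁ hsub₁ hp₁,
        isEndpoint_preimage hτ₂ hsub₂ hp₂⟩
      rw [h]
      ext z
      rw [mem_preimage, mem_singleton_iff, mem_singleton_iff, Subtype.ext_iff]

/-- `p` and `q` are the ends of a segment other than `e`. -/
def AdjOff (V e : Set Γ) (p q : Γ) : Prop :=
  ∃ E ∈ segments V, E ≠ e ∧ ∃ l σ, IsParam E l σ ∧ σ 0 = p ∧ σ l = q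

theorem adj_deletion_iff (hΓ : IsMetrizedGraph Γ) (hV : IsVertexSet V)
    (he : e ∈ segments V) (hs : IsParam e L s) {p q : ↥(s '' Ioo 0 L)ᶜ} :
    Adj (Subtype.val ⁻¹' V) p q ↔ AdjOff V e p q := by
  constructor
  · rintro ⟨E', hE', l, σ, hσ, rfl, rfl⟩
    obtain ⟨E, hE, hne, rfl⟩ := (mem_segments_deletion_iff hΓ hV he hs).1 hE'
    refine ⟨E, hE, hne, l, fun t => σ t, ⟨hσ.pos, hσ.dist_eq, ?_⟩, rfl, rfl⟩
    have h1 : (fun t => (σ t : Γ)) '' Icc 0 l = Subtype.val '' (σ '' Icc 0 l) :=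
      (image_image _ _ _).symm
    rw [h1, hσ.image_eq, Subtype.image_preimage_coe,
      inter_eq_right.2 (subset_deletion hΓ hV he hs hE hne)]
  · rintro ⟨E, hE, hne, l, τ, hτ, h0, h1⟩
    obtain ⟨σ, hσ, hστ⟩ := hτ.exists_lift (subset_deletion hΓ hV he hs hE hne)
    exact ⟨_, (mem_segments_deletion_iff hΓ hV he hs).2 ⟨E, hE, hne, rfl⟩, l, σ, hσ,
      Subtype.ext ((hστ 0 hτ.zero_mem).trans h0), Subtype.ext ((hστ l hτ.length_mem).trans h1)⟩

open Classical in
/-- The contribution of one segment to the slopes at the vertices. -/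
theorem slopeSum_eq_add_of_segment (hΓ : IsMetrizedGraph Γ) (hV : IsVertexSet V)
    (he : e ∈ segments V) (hs : IsParam e L s) {f : Γ → ℝ} (hf : IsQuadratic V 0 f) {p : Γ}
    (hp : p ∈ V) :
    slopeSum f p = ∑ q ∈ (neighbours hV p).filter (AdjOff V e p), (f q - f p) / dist p q +
      (delta (s 0) p - delta (s L) p) * ((f (s L) - f (s 0)) / L) := by
  rw [hf.slopeSum_of_mem hΓ hV hp (fun q => (f q - f p) / dist p q) (by
      rintro E - l σ hσ rfl
      rw [hσ.dist_ends, Pi.zero_apply]; ring),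
    ← Finset.sum_filter_add_sum_filter_not _ (AdjOff V e p)]
  congr 1
  have hset : ∀ q, q ∈ (neighbours hV p).filter (fun q => ¬ AdjOff V e p q) ↔
      (p = s 0 ∧ q = s L) ∨ (p = s L ∧ q = s 0) := by
    intro q
    rw [Finset.mem_filter, mem_neighbours hΓ]
    have hoff : ∀ u v, u ≠ v → u ∈ e → v ∈ e → ¬ AdjOff V e u v := by
      rintro u v huv hu hv ⟨E, hE, hne, l, σ, hσ, rfl, rfl⟩
      exact hne (segment_eq_of_two_mem hV hE he huv (hσ.apply_mem hσ.zero_mem) hu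
        (hσ.apply_mem hσ.length_mem) hv)
    have h0 := hs.apply_mem hs.zero_mem
    have h1 := hs.apply_mem hs.length_mem
    constructor
    · rintro ⟨⟨E, hE, l, σ, hσ, rfl, rfl⟩, hnot⟩
      have hEe : E = e := by
        by_contra hne
        exact hnot ⟨E, hE, hne, l, σ, hσ, rfl, rfl⟩
      subst hEe
      obtain ⟨rfl, H | H⟩ := hs.eq_or_reverse hσ
      · exact Or.inl ⟨H 0 hs.zero_mem, H _ hs.length_mem⟩
      · exact Or.inr ⟨by simpa using H 0 hs.zero_mem, by simpa using H _ hs.length_mem⟩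
    · have hadj : Adj V (s 0) (s L) := ⟨e, he, L, s, hs, rfl, rfl⟩
      rintro (⟨rfl, rfl⟩ | ⟨rfl, rfl⟩)
      · exact ⟨hadj, hoff _ _ hs.ends_ne h0 h1⟩
      · exact ⟨hadj.symm, hoff _ _ hs.ends_ne.symm h1 h0⟩
  by_cases h0 : p = s 0
  · have : (neighbours hV p).filter (fun q => ¬ AdjOff V e p q) = {s L} := by
      ext q
      rw [hset, Finset.mem_singleton, h0]
      simp [hs.ends_ne]
    rw [this, Finset.sum_singleton, h0, hs.dist_ends, delta_self, delta_of_ne hs.ends_ne]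
    ring
  by_cases h1 : p = s L
  · have : (neighbours hV p).filter (fun q => ¬ AdjOff V e p q) = {s 0} := by
      ext q
      rw [hset, Finset.mem_singleton, h1]
      simp [hs.ends_ne.symm]
    rw [this, Finset.sum_singleton, h1, dist_comm, hs.dist_ends, delta_self,
      delta_of_ne hs.ends_ne.symm]
    ring
  · have : (neighbours hV p).filter (fun q => ¬ AdjOff V e p q) = ∅ := by
      ext q
      rw [hset]
      simp [h0, h1]
    rw [this, Finset.sum_empty, delta_of_ne h0, delta_of_ne h1]
    ring

end Deletion

/-! ### The resistance between the ends of a segment -/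

section DeletedResistance

variable {Γ : Type*} [MetricSpace Γ] [MeasurableSpace Γ] [BorelSpace Γ] {V : Set Γ}
  {e : Set Γ} {L : ℝ} {s : ℝ → Γ}

/-- If `Γ ∖ e°` is disconnected, all current between the ends flows through `e`: the potential is
constant on the two parts of `Γ ∖ e°`. -/
theorem effResistance_of_not_isConnected (hΓ : IsMetrizedGraph Γ) (hV : IsVertexSet V)
    (he : e ∈ segments V) (hs : IsParam e L s) (hconn : ¬ IsConnected (s '' Ioo 0 L)ᶜ) :
    effResistance (s 0) (s L) = L := by
  classical
  have := hΓ.connected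
  obtain ⟨h0, h1⟩ := ends_mem hΓ hV he hs
  have h0A := vertex_mem_deletion hΓ hV he hs h0
  have h1A := vertex_mem_deletion hΓ hV he hs h1
  set A := (s '' Ioo 0 L)ᶜ with hA
  have hAcl : IsClosed A := (isOpen_image_Ioo hΓ hV he hs).isClosed_compl
  have hpre : ¬ IsPreconnected A := fun h => hconn ⟨⟨_, h0A⟩, h⟩
  -- a part of `Γ ∖ e°` contains an end of `e`, since `Γ` is connected
  have hend : ∀ T T' : Set Γ, IsClosed T → IsClosed T' → A ⊆ T ∪ T' → (A ∩ T).Nonempty →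
      ¬ (A ∩ (T ∩ T')).Nonempty → s 0 ∈ T ∨ s L ∈ T := by
    intro T T' hT hT' hsub hne hdisj
    by_contra! hnot
    have huniv : (univ : Set Γ) ⊆ (A ∩ T) ∪ ((A ∩ T') ∪ e) := by
      intro x _
      by_cases hx : x ∈ A
      · exact (hsub hx).imp (fun h => ⟨hx, h⟩) fun h => Or.inl ⟨hx, h⟩
      · rw [hA, notMem_compl_iff, hs.image_Ioo] at hx
        exact Or.inr (Or.inr hx.1)
    obtain ⟨x, -, ⟨hxA, hxT⟩, hx⟩ := isPreconnected_closed_iff.1 isPreconnected_univ _ _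
      (hAcl.inter hT) ((hAcl.inter hT').union hs.isClosed) huniv
      (by simpa using hne) (by simpa using Or.inr ⟨_, hs.apply_mem hs.zero_mem⟩)
    rcases hx with hx | hx
    · exact hdisj ⟨x, hxA, hxT, hx.2⟩
    · by_cases hxe : x ∈ ({s 0, s L} : Set Γ)
      · rcases hxe with rfl | rfl
        · exact hnot.1 hxT
        · exact hnot.2 hxT
      · refine hxA ?_
        rw [hs.image_Ioo]; exact ⟨hx, hxe⟩
  obtain ⟨U, U', hU, hU', hcov, hdisj, h0U, h1U'⟩ : ∃ U U' : Set Γ, IsClosed U ∧ IsClosed U' ∧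
      A ⊆ U ∪ U' ∧ ¬ (A ∩ (U ∩ U')).Nonempty ∧ s 0 ∈ U ∧ s L ∈ U' := by
    rw [isPreconnected_closed_iff] at hpre
    push Not at hpre
    obtain ⟨T, T', hT, hT', hsub, hne, hne', hdisj⟩ := hpre
    have hdisj1 : ¬ (A ∩ (T ∩ T')).Nonempty := not_nonempty_iff_eq_empty.2 hdisj
    have hdisj2 : ¬ (A ∩ (T' ∩ T)).Nonempty := by rwa [inter_comm T']
    have hsub2 : A ⊆ T' ∪ T := by rwa [union_comm]
    rcases hend T T' hT hT' hsub hne hdisj1 with h | h <;>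
      rcases hend T' T hT' hT hsub2 hne' hdisj2 with h' | h'
    · exact absurd ⟨_, h0A, h, h'⟩ hdisj1
    · exact ⟨T, T', hT, hT', hsub, hdisj1, h, h'⟩
    · exact ⟨T', T, hT', hT, hsub2, hdisj2, h', h⟩
    · exact absurd ⟨_, h1A, h, h'⟩ hdisj1
  have hnotboth : ∀ x ∈ A, x ∈ U → x ∉ U' := fun x hx h h' => hdisj ⟨x, hx, h, h'⟩
  let f : Γ → ℝ := fun x => if x ∈ e then L - dist x (s 0) else if x ∈ U then L else 0
  have hfe : ∀ t ∈ Icc 0 L, f (s t) = L - t := fun t ht => by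
    simp only [f, if_pos (hs.apply_mem ht), hs.dist_left ht]
  have hf0 : f (s 0) = L := by rw [hfe 0 hs.zero_mem, sub_zero]
  have hf1 : f (s L) = 0 := by rw [hfe L hs.length_mem, sub_self]
  have hfA : ∀ x ∈ A, f x = if x ∈ U then L else 0 := by
    intro x hx
    by_cases hxe : x ∈ e
    · have hx' : x ∈ ({s 0, s L} : Set Γ) := by
        by_contra hn
        refine hx ?_
        rw [hs.image_Ioo]; exact ⟨hxe, hn⟩
      rcases hx' with rfl | rfl
      · rw [hf0, if_pos h0U]
      · rw [hf1, if_neg fun h => hnotboth _ h1A h h1U']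
    · simp only [f, if_neg hxe]
  have hconst : ∀ E ∈ segments V, E ≠ e → ∀ x ∈ E, ∀ x' ∈ E, f x = f x' := by
    intro E hE hne x hx x' hx'
    have hEA := subset_deletion hΓ hV he hs hE hne
    obtain ⟨l, σ, hσ⟩ := hV.segment E hE
    have hEpre : IsPreconnected E := by
      rw [← hσ.image_eq]; exact isPreconnected_Icc.image _ hσ.continuousOn
    have hsplit : E ⊆ U ∨ E ⊆ U' := by
      by_contra! hn
      obtain ⟨⟨u, hu, huU⟩, v, hv, hvU⟩ :=
        (⟨not_subset.1 hn.1, not_subset.1 hn.2⟩ : (∃ a ∈ E, a ∉ U) ∧ ∃ a ∈ E, a ∉ U')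
      obtain ⟨w, hw, hwU⟩ := isPreconnected_closed_iff.1 hEpre U U' hU hU' (hEA.trans hcov)
        ⟨v, hv, (hcov (hEA hv)).resolve_right hvU⟩ ⟨u, hu, (hcov (hEA hu)).resolve_left huU⟩
      exact hdisj ⟨w, hEA hw, hwU⟩
    rw [hfA x (hEA hx), hfA x' (hEA hx')]
    rcases hsplit with h | h
    · rw [if_pos (h hx), if_pos (h hx')]
    · rw [if_neg fun H => hnotboth _ (hEA hx) H (h hx),
        if_neg fun H => hnotboth _ (hEA hx') H (h hx')]
  have hq : IsQuadratic V 0 f := by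
    refine isQuadratic_of_exists_param fun E hE => ?_
    by_cases hne : E = e
    · subst hne
      exact ⟨L, s, hs, -1, L, fun t ht => by rw [hfe t ht, Pi.zero_apply]; ring⟩
    · obtain ⟨l, σ, hσ⟩ := hV.segment E hE
      refine ⟨l, σ, hσ, 0, f (σ 0), fun t ht => ?_⟩
      rw [hconst E hE hne _ (hσ.apply_mem ht) _ (hσ.apply_mem hσ.zero_mem), Pi.zero_apply]
      ring
  have hslope : ∀ p, slopeSum f p = delta (s L) p - delta (s 0) p := by
    intro p
    by_cases hp : p ∈ V
    · rw [slopeSum_eq_add_of_segment hΓ hV he hs hq hp, hf0, hf1, Finset.sum_eq_zero]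
      · have := hs.pos.ne'
        field_simp
        ring
      · intro q hqm
        obtain ⟨E, hE, hne, l, σ, hσ, rfl, rfl⟩ := (Finset.mem_filter.1 hqm).2
        rw [hconst E hE hne _ (hσ.apply_mem hσ.length_mem) _ (hσ.apply_mem hσ.zero_mem), sub_self,
          zero_div]
    · rw [hq.slopeSum_of_notMem hΓ hV hp, delta_of_ne (by rintro rfl; exact hp h1),
        delta_of_ne (by rintro rfl; exact hp h0), sub_zero]
  rw [effResistance, eq_jFun hΓ hV h1 h0 hq hf1 hslope, hf0]

/-- If `Γ ∖ e°` is connected, the segment and its complement are connected in parallel: a potential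
on `Γ ∖ e°`, extended affinely over `e`, is a multiple of the potential on `Γ`. -/
theorem effResistanceOn_eq_mul (hΓ : IsMetrizedGraph Γ) (hV : IsVertexSet V)
    (he : e ∈ segments V) (hs : IsParam e L s) (hconn : IsConnected (s '' Ioo 0 L)ᶜ) :
    effResistanceOn (s '' Ioo 0 L)ᶜ (s 0) (s L) =
      (1 + effResistanceOn (s '' Ioo 0 L)ᶜ (s 0) (s L) / L) * effResistance (s 0) (s L) := by
  classical
  obtain ⟨h0, h1⟩ := ends_mem hΓ hV he hs
  have h0A := vertex_mem_deletion hΓ hV he hs h0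
  have h1A := vertex_mem_deletion hΓ hV he hs h1
  have hΓ' := isMetrizedGraph_deletion hΓ hV he hs hconn
  have hV' := isVertexSet_deletion hΓ hV he hs hΓ'
  rw [effResistanceOn, dif_pos ⟨h0A, h1A⟩, effResistance]
  obtain ⟨hj, hj0, hjs⟩ := jFun_spec hΓ' hV' (y := ⟨s L, h1A⟩) (z := ⟨s 0, h0A⟩) h1 h0
  set j := jFun (⟨s L, h1A⟩ : ↥(s '' Ioo 0 L)ᶜ) ⟨s 0, h0A⟩ with hjdef
  set R := j ⟨s 0, h0A⟩ with hR
  let f : Γ → ℝ := fun x => if h : x ∈ (s '' Ioo 0 L)ᶜ then j ⟨x, h⟩ else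
    R * (1 - dist x (s 0) / L)
  have hfA : ∀ x : ↥(s '' Ioo 0 L)ᶜ, f x = j x := fun x => by
    simp only [f, dif_pos x.2]
  have hf0 : f (s 0) = R := hfA ⟨s 0, h0A⟩
  have hf1 : f (s L) = 0 := (hfA ⟨s L, h1A⟩).trans hj0
  have hq : IsQuadratic V 0 f := by
    refine isQuadratic_of_exists_param fun E hE => ?_
    by_cases hne : E = e
    · subst hne
      refine ⟨L, s, hs, -R / L, R, fun t ht => ?_⟩
      rw [Pi.zero_apply]
      rcases ht.1.eq_or_lt with rfl | ht0
      · rw [hf0]; ring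
      rcases ht.2.eq_or_lt with rfl | htL
      · rw [hf1]; have := ht0.ne'; field_simp; ring
      have hn : ¬ s t ∈ (s '' Ioo 0 L)ᶜ := fun h => h (mem_image_of_mem _ ⟨ht0, htL⟩)
      simp only [f, dif_neg hn, hs.dist_left ht]
      ring
    · obtain ⟨l, τ, hτ⟩ := hV.segment E hE
      obtain ⟨σ, hσ, hστ⟩ := hτ.exists_lift (subset_deletion hΓ hV he hs hE hne)
      obtain ⟨B, C, H⟩ := hj _ ((mem_segments_deletion_iff hΓ hV he hs).2 ⟨E, hE, hne, rfl⟩) l σ hσ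
      exact ⟨l, τ, hτ, B, C, fun t ht => by rw [← hστ t ht, hfA, H t ht]; rfl⟩
  have hslope : ∀ p, slopeSum f p = (1 + R / L) * (delta (s L) p - delta (s 0) p) := by
    intro p
    by_cases hp : p ∈ V
    · have hpA := vertex_mem_deletion hΓ hV he hs hp
      have hsum : ∑ q ∈ (neighbours hV p).filter (AdjOff V e p), (f q - f p) / dist p q =
          slopeSum j ⟨p, hpA⟩ := by
        have hset : (neighbours hV p).filter (AdjOff V e p) =
            (neighbours hV' ⟨p, hpA⟩).image Subtype.val := by
          ext q
          rw [Finset.mem_filter, mem_neighbours hΓ, Finset.mem_image]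
          constructor
          · rintro ⟨hadj, hoff⟩
            have hqA := vertex_mem_deletion hΓ hV he hs (hadj.right_mem hΓ hV)
            exact ⟨⟨q, hqA⟩, (mem_neighbours hΓ' hV').2
              ((adj_deletion_iff hΓ hV he hs (p := ⟨p, hpA⟩) (q := ⟨q, hqA⟩)).2 hoff), rfl⟩
          · rintro ⟨q', hq', rfl⟩
            have hoff := (adj_deletion_iff hΓ hV he hs).1 ((mem_neighbours hΓ' hV').1 hq')
            obtain ⟨E, hE, hne, l, σ, hσ⟩ := id hoff
            exact ⟨⟨E, hE, l, σ, hσ⟩, hoff⟩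
        rw [hset, Finset.sum_image fun a _ b _ hab => Subtype.val_injective hab,
          hj.slopeSum_of_mem hΓ' hV' (p := ⟨p, hpA⟩) hp
            (fun q => (j q - j ⟨p, hpA⟩) / dist (⟨p, hpA⟩ : ↥(s '' Ioo 0 L)ᶜ) q)]
        · refine Finset.sum_congr rfl fun q _ => ?_
          rw [hfA, Subtype.dist_eq]
          exact congrArg (fun u => (j q - u) / dist p (q : Γ)) (hfA ⟨p, hpA⟩)
        · rintro E - l σ hσ h
          rw [← h, hσ.dist_ends, Pi.zero_apply]; ring
      have hdelta : ∀ (u : Γ) (hu : u ∈ (s '' Ioo 0 L)ᶜ),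
          delta (⟨u, hu⟩ : ↥(s '' Ioo 0 L)ᶜ) ⟨p, hpA⟩ = delta u p := fun u hu => by
        by_cases h : p = u
        · subst h; rw [delta_self, delta_self]
        · rw [delta_of_ne h, delta_of_ne fun H => h (congrArg Subtype.val H)]
      rw [slopeSum_eq_add_of_segment hΓ hV he hs hq hp, hsum, hjs, hf0, hf1, hdelta, hdelta]
      ring
    · rw [hq.slopeSum_of_notMem hΓ hV hp, delta_of_ne (by rintro rfl; exact hp h1),
        delta_of_ne (by rintro rfl; exact hp h0), sub_zero, mul_zero]
  obtain ⟨hg, hg0, hgs⟩ := jFun_spec hΓ hV h1 h0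
  have hgl := hg.isLocallyAffine hΓ hV
  have hfl := hq.isLocallyAffine hΓ hV
  have hconst := (hfl.add_const_mul hgl (-(1 + R / L))).eq_of_slopeSum_eq_zero hΓ (y := s L)
    (fun p _ => by
      rw [slopeSum_add_const_mul (hfl.differentiable_arm p) (hgl.differentiable_arm p), hslope,
        hgs]
      ring) (s 0)
  rw [hf0, hf1, hg0] at hconst
  rw [effResistance]
  linarith

/-- Both cases in terms of the density of the canonical measure. -/
theorem toReal_inv_deletedResistance_add (hΓ : IsMetrizedGraph Γ) (hV : IsVertexSet V)
    (he : e ∈ segments V) (hs : IsParam e L s) :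
    ((deletedResistance L s + (L : EReal))⁻¹).toReal =
      1 / L - effResistance (s 0) (s L) / L ^ 2 := by
  have hL := hs.pos.ne'
  by_cases hconn : IsConnected (s '' Ioo 0 L)ᶜ
  · have h := effResistanceOn_eq_mul hΓ hV he hs hconn
    rw [deletedResistance, if_pos hconn, ← EReal.coe_add, ← EReal.coe_inv, EReal.toReal_coe]
    set R := effResistanceOn (s '' Ioo 0 L)ᶜ (s 0) (s L)
    -- `R = -L` would give `R = 0`
    have hne : R + L ≠ 0 := by
      intro H
      have : 1 + R / L = 0 := by field_simp; linarith
      rw [this, zero_mul] at h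
      rw [h, zero_add] at H
      exact hL H
    generalize effResistance (s 0) (s L) = ρ at h
    field_simp at h ⊢
    linear_combination -h
  · rw [deletedResistance, if_neg hconn, effResistance_of_not_isConnected hΓ hV he hs hconn,
      EReal.top_add_coe, EReal.inv_top, EReal.toReal_zero]
    field_simp
    ring

end DeletedResistance

end MetrizedGraph

end

/-- Let `V` be a vertex set of the metrized graph `Γ`, and let each segment `e` be parametrized by
an isometry `s e : [0, L e] → e`. For every `y`, the function `x ↦ r(x, y)` is piecewise smooth, and
`½ Δ_x r(x, y) + δ_y = ∑_p (1 - n_p / 2) δ_p + ∑_e (R_e + L_e)⁻¹ dx|_e`. -/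
theorem mainTheorem3 {Γ : Type*} [MetricSpace Γ] [MeasurableSpace Γ] [BorelSpace Γ]
    (hΓ : IsMetrizedGraph Γ) (V : Set Γ) (hV : IsVertexSet V)
    (L : Set Γ → ℝ) (s : Set Γ → ℝ → Γ) (hs : ∀ e ∈ segments V, IsParam e (L e) (s e)) (y : Γ) :
    (segments V).Finite ∧
    IsPiecewiseSmooth (fun x => effResistance x y) ∧
    canonicalMeasure y =
      (∑ᶠ p ∈ V, (1 - (valence p : ℝ) / 2) • pointMass p) +
      ∑ᶠ e ∈ segments V,
        ((deletedResistance (L e) (s e) + (L e : EReal))⁻¹).toReal • arcLengthOn e := by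
  obtain ⟨z, hz⟩ := hV.nonempty
  have hfin := segments_finite hΓ hV
  refine ⟨hfin, isPiecewiseSmooth_effResistance hΓ hV y, ?_⟩
  rw [canonicalMeasure_eq_of_mem hΓ hV hz y, canonicalMeasure_eq hΓ hV hz hs,
    finsum_mem_eq_finite_toFinset_sum _ hV.finite, finsum_mem_eq_finite_toFinset_sum _ hfin]
  congr 1
  refine Finset.sum_congr rfl fun e he => ?_
  have he' := hfin.mem_toFinset.1 he
  rw [toReal_inv_deletedResistance_add hΓ hV he' (hs e he')]
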